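/- Let $n\ge 1$ and let $S=\{x\in\mathbb R^{n+1}\mid \sum_{j=1}^{n+1}x_j=1,\ x_j\ge 0\}$ be the regular $n$-simplex with vertices $e_1,\dots,e_{n+1}$ and centroid $c=\frac1{n+1}(1,\dots,1)$. For $a\in\mathbb R^{n+1}$ with $\|a\|=1$ (Euclidean norm) let $H_a=\{x\in\mathbb R^{n+1}\mid\langle a,x\rangle=0\}$, and let $\mathrm{vol}_{n-1}$ be the $(n-1)$-dimensional Lebesgue volume induced on $(n-1)$-dimensional affine subspaces (counting measure if $n=1$). If the positive entries of $a$ are pairwise distinct, put $$F(a)=\sum_{j:\,a_j>0}\frac1{a_j}\prod_{k\ne j}\frac1{1-a_k/a_j}.$$ (a) Let $0\le K\le 1$. For all $a\in\mathbb R^{n+1}$ with $\|a\|=1$ and $\sum_{j=1}^{n+1}a_j=K$, $$\mathrm{vol}_{n-1}(H_a\cap S)\le\frac{\sqrt{n+1-K^2}}{(n-1)!}\,\frac1{\sqrt{2-K^2}},$$ and, if the positive entries of $a$ are pairwise distinct, $F(a)\le \frac1{\sqrt{2-K^2}}$. Equality holds in both inequalities for $a=\left(\frac K2+\sqrt{\frac12-\frac{K^2}4},\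 \frac K2-\sqrt{\frac12-\frac{K^2}4},\ 0,\dots,0\right)$ and for every vector obtained from it by permuting its entries; each such vector satisfies $\|a\|=1$ and $\sum_j a_j=K$, its positive entries are pairwise distinct, and $H_a$ contains the $n-1$ vertices $e_k$ for which $k$ is not one of the two distinguished positions. (b) Let $d\ge 0$ be at most the distance from $c$ to the facets of $S$. Among the non-empty sections $H_a\cap S$, $\|a\|=1$, with $\mathrm{dist}(c,H_a\cap S)=d$ there is one for which $H_a$ contains at least $n-1$ vertices of $S$, and every such section has the largest $(n-1)$-volume among all non-empty sections at distance $d$ from $c$. (c) In particular (Webb's theorem), if $\|a\|=1$ and $c\in H_a$, then $\mathrm{vol}_{n-1}(H_a\cap S)\le\frac{\sqrt{n+1}}{(n-1)!}\frac1{\sqrt2}$, with equality if $H_a$ contains at least $n-1$ vertices of $S$. -/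

import Mathlib

open MeasureTheory

noncomputable section

namespace SimplexSection

/-- The regular simplex `S` of dimension `n` (side length `√2`), embedded in `ℝ^(n+1)`. -/
def simplex (n : ℕ) : Set (EuclideanSpace ℝ (Fin (n + 1))) :=
  {x | ∑ j, x j = 1 ∧ ∀ j, 0 ≤ x j}

/-- The vertex `e_j` of the simplex. -/
def vertex (n : ℕ) (j : Fin (n + 1)) : EuclideanSpace ℝ (Fin (n + 1)) :=
  EuclideanSpace.single j 1

/-- The centroid `(1/(n+1), …, 1/(n+1))` of the simplex. -/
def centroid (n : ℕ) : EuclideanSpace ℝ (Fin (n + 1)) :=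
  WithLp.toLp 2 fun _ => 1 / ((n : ℝ) + 1)

/-- The facet of the simplex opposite to the vertex `e_j`. -/
def facet (n : ℕ) (j : Fin (n + 1)) : Set (EuclideanSpace ℝ (Fin (n + 1))) :=
  {x | x ∈ simplex n ∧ x j = 0}

/-- The linear hyperplane `H_a` orthogonal to `a`. -/
def hyperplane {n : ℕ} (a : EuclideanSpace ℝ (Fin (n + 1))) :
    Set (EuclideanSpace ℝ (Fin (n + 1))) :=
  {x | inner ℝ a x = 0}

/-- The section `H_a ∩ S`. -/
def sec {n : ℕ} (a : EuclideanSpace ℝ (Fin (n + 1))) : Set (EuclideanSpace ℝ (Fin (n + 1))) :=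
  hyperplane a ∩ simplex n

/-- The `(n-1)`-dimensional volume of `H_a ∩ S`. The Euclidean Hausdorff measure `μHE[d]` is
normalized so that it is the Lebesgue measure on every `d`-dimensional affine subspace. -/
def secVol {n : ℕ} (a : EuclideanSpace ℝ (Fin (n + 1))) : ENNReal :=
  μHE[n - 1] (sec a)

/-- The hyperplane `H_a` contains (at least) `n - 1` of the `n + 1` vertices of the simplex. -/
def ContainsVertices {n : ℕ} (a : EuclideanSpace ℝ (Fin (n + 1))) : Prop :=
  ∃ i j : Fin (n + 1), i ≠ j ∧ ∀ k, k ≠ i → k ≠ j → vertex n k ∈ hyperplane a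

/-- `a` is a unit vector such that the section `H_a ∩ S` is non-empty and has distance `d` from the
centroid. -/
def AtDist {n : ℕ} (d : ℝ) (a : EuclideanSpace ℝ (Fin (n + 1))) : Prop :=
  ‖a‖ = 1 ∧ (sec a).Nonempty ∧ Metric.infDist (centroid n) (sec a) = d

/-- The vector with entry `K/2 + √(1/2 - K²/4)` at position `i`, entry `K/2 - √(1/2 - K²/4)` at
position `j`, and zeros elsewhere (used for `i ≠ j`). -/
def extremal (n : ℕ) (K : ℝ) (i j : Fin (n + 1)) : EuclideanSpace ℝ (Fin (n + 1)) :=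
  EuclideanSpace.single i (K / 2 + √(1 / 2 - K ^ 2 / 4)) +
    EuclideanSpace.single j (K / 2 - √(1 / 2 - K ^ 2 / 4))

open Classical in
/-- `F(a) = ∑_{a_j > 0} (1 / a_j) ∏_{k ≠ j} 1 / (1 - a_k / a_j)`, meaningful when the positive
entries of `a` are pairwise distinct. -/
def F {n : ℕ} (a : EuclideanSpace ℝ (Fin (n + 1))) : ℝ :=
  ∑ j with 0 < a j, 1 / a j * ∏ k ∈ Finset.univ.erase j, 1 / (1 - a k / a j)

/-- The positive entries of `a` are pairwise distinct. -/
def PosDistinct {n : ℕ} (a : EuclideanSpace ℝ (Fin (n + 1))) : Prop :=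
  ∀ j k, 0 < a j → 0 < a k → a j = a k → j = k

end SimplexSection

end

/-! Let `X j` be independent standard exponential variables. Normalized by its sum, the vector `X`
is uniform on the simplex, so the density of `∑ a j * X j` at 0 measures the section: with `K = ∑ a
j`, its volume is `√(n+1-K²)/(n-1)!` times that density (`secVol_eq`). A partial fraction expansion
shows that `F a` is the same density value (`F_eq_foldr`). Both inequalities therefore reduce to one
bound, `foldr_expSmooth_le`. The density itself is produced by iterating `expSmooth`, one summand at
a time.

The density `f` has mean `K` and variance `∑ a j ^ 2 = 1`. Smoothing preserves log-concavity, and a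
negative coefficient makes `f` continuous and positive. Let `g` be the density of `p X - q Y` with
`p - q = K` and `p + q = √(2-K²)`; it has the same mean and variance, and `g 0 = 1/√(2-K²)`. If `f 0
> g 0`, log-concavity against exponentials lets `f - g` change sign at most once on each side of 0,
from positive to negative. A polynomial of degree at most two vanishing at the crossings makes `(f -
g)` times it non-negative, while equality of the moments makes its integral zero, a contradiction
(`IsLogConcave.apply_zero_le`). The extremal vectors are those for which `f` is `g` itself.

For the statement about distances, the section is at distance `d` from the centroid with
`(n+1)(n+1-K²)d² = K²` as soon as `K² ≤ 1`, because the foot of the perpendicular then lies in the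
simplex. Having `d` at most the distance to the facets forces `K² ≤ 1`, so `d` determines `K²`, and
replacing `a` by `-a` gives `0 ≤ K ≤ 1`. -/

noncomputable section

namespace SimplexSection

open Set Real

/-! ### Exponential smoothing. -/

section

/-- The density of `a X`, where `X` is a standard exponential variable and `0 < a`. -/
def expDensity (a t : ℝ) : ℝ := if 0 ≤ t then exp (-t / a) / a else 0

/-- If `f` is the density of `Y` and `X` is an independent standard exponential variable, then
`expSmooth a f` is the density of `Y + a X`. -/
def expSmooth (a : ℝ) (f : ℝ → ℝ) (t : ℝ) : ℝ := ∫ x in Ioi 0, exp (-x) * f (t - a * x)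

/-- Non-negative bounded measurable functions on the line. -/
structure IsTame (f : ℝ → ℝ) : Prop where
  measurable : Measurable f
  nonneg : ∀ t, 0 ≤ f t
  bounded : ∃ C, ∀ t, f t ≤ C

lemma integrableOn_exp_neg : IntegrableOn (fun x : ℝ => exp (-x)) (Ioi 0) := by
  simpa using integrableOn_exp_mul_Ioi (a := -1) (by norm_num) 0

lemma integrableOn_exp_neg_mul {f : ℝ → ℝ} (hm : Measurable f) {C : ℝ} (hC : ∀ t, |f t| ≤ C) :
    IntegrableOn (fun x : ℝ => exp (-x) * f x) (Ioi 0) :=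
  integrableOn_exp_neg.mul_bdd (c := C) hm.aestronglyMeasurable
    (Filter.Eventually.of_forall fun x => by simpa using hC x)

namespace IsTame

variable {f : ℝ → ℝ}

lemma comp (hf : IsTame f) {g : ℝ → ℝ} (hg : Measurable g) : IsTame (fun x => f (g x)) :=
  ⟨hf.measurable.comp hg, fun _ => hf.nonneg _, hf.bounded.imp fun _ hC _ => hC _⟩

lemma integrableOn (hf : IsTame f) : IntegrableOn (fun x : ℝ => exp (-x) * f x) (Ioi 0) := by
  obtain ⟨C, hC⟩ := hf.bounded
  exact integrableOn_exp_neg_mul hf.measurable (C := C) fun t => by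
    rw [abs_of_nonneg (hf.nonneg t)]; exact hC t

lemma integrableOn_shift (hf : IsTame f) (a t : ℝ) :
    IntegrableOn (fun x : ℝ => exp (-x) * f (t - a * x)) (Ioi 0) :=
  (hf.comp (g := fun x => t - a * x) (by fun_prop)).integrableOn

lemma expSmooth (hf : IsTame f) (a : ℝ) : IsTame (expSmooth a f) := by
  refine ⟨?_, fun t => ?_, ?_⟩
  · have h : StronglyMeasurable fun p : ℝ × ℝ => exp (-p.2) * f (p.1 - a * p.2) :=
      (Measurable.mul (by fun_prop) (hf.measurable.comp (by fun_prop))).stronglyMeasurable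
    exact (h.integral_prod_right' (ν := volume.restrict (Ioi 0))).measurable
  · exact integral_nonneg fun x => mul_nonneg (exp_pos _).le (hf.nonneg _)
  · obtain ⟨C, hC⟩ := hf.bounded
    refine ⟨C, fun t => ?_⟩
    calc _ ≤ ∫ x in Ioi 0, exp (-x) * C := integral_mono (hf.integrableOn_shift a t)
            (integrableOn_exp_neg.mul_const C)
            fun x => mul_le_mul_of_nonneg_left (hC _) (exp_pos _).le
      _ = C := by rw [integral_mul_const, integral_exp_neg_Ioi_zero, one_mul]

lemma foldr (hf : IsTame f) (l : List ℝ) : IsTame (l.foldr SimplexSection.expSmooth f) := by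
  induction l with
  | nil => exact hf
  | cons a l ih => exact ih.expSmooth a

lemma integrable_expSmooth_prod (hf : IsTame f) (a b t : ℝ) :
    Integrable (fun p : ℝ × ℝ => exp (-p.1) * (exp (-p.2) * f (t - a * p.1 - b * p.2)))
      ((volume.restrict (Ioi 0)).prod (volume.restrict (Ioi 0))) := by
  obtain ⟨C, hC⟩ := hf.bounded
  have := (integrableOn_exp_neg.integrable.mul_prod integrableOn_exp_neg.integrable).mul_bdd
    (c := C) (g := fun p : ℝ × ℝ => f (t - a * p.1 - b * p.2))
    (hf.measurable.comp (by fun_prop)).aestronglyMeasurable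
    (Filter.Eventually.of_forall fun x => by
      simpa [abs_of_nonneg (hf.nonneg _)] using hC _)
  simpa only [mul_assoc] using this

/-- Fubini. Together with `foldr_perm` it makes the order of the coefficients irrelevant, which is
used later to apply a convenient coefficient first. -/
lemma expSmooth_comm (hf : IsTame f) (a b : ℝ) :
    SimplexSection.expSmooth a (SimplexSection.expSmooth b f) =
      SimplexSection.expSmooth b (SimplexSection.expSmooth a f) := by
  funext t
  have h := integral_integral_swap
    (f := fun x y => exp (-x) * (exp (-y) * f (t - a * x - b * y))) (hf.integrable_expSmooth_prod a b t)
  simp only [SimplexSection.expSmooth, ← integral_const_mul]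
  rw [h]
  refine integral_congr_ae (Filter.Eventually.of_forall fun x => ?_)
  refine integral_congr_ae (Filter.Eventually.of_forall fun y => ?_)
  simp only
  rw [mul_left_comm, sub_right_comm]

lemma foldr_perm (hf : IsTame f) {l l' : List ℝ} (h : l.Perm l') :
    l.foldr SimplexSection.expSmooth f = l'.foldr SimplexSection.expSmooth f := by
  induction h with
  | nil => rfl
  | cons a _ ih => simp [ih]
  | swap a b l => exact (hf.foldr l).expSmooth_comm b a
  | trans _ _ h₁ h₂ => exact h₁.trans h₂

lemma ofReal_expSmooth (hf : IsTame f) (a t : ℝ) :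
    ENNReal.ofReal (SimplexSection.expSmooth a f t) =
      ∫⁻ x in Ioi 0, ENNReal.ofReal (exp (-x)) * ENNReal.ofReal (f (t - a * x)) := by
  rw [SimplexSection.expSmooth, ofReal_integral_eq_lintegral_ofReal (hf.integrableOn_shift a t)
    (Filter.Eventually.of_forall fun x => mul_nonneg (exp_pos _).le (hf.nonneg _))]
  simp_rw [ENNReal.ofReal_mul (exp_pos _).le]

end IsTame

lemma expSmooth_zero (f : ℝ → ℝ) : expSmooth 0 f = f := by
  funext t
  simp only [expSmooth, zero_mul, sub_zero]
  rw [integral_mul_const, integral_exp_neg_Ioi_zero, one_mul]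

lemma isTame_expDensity {a : ℝ} (ha : 0 < a) : IsTame (expDensity a) := by
  refine ⟨?_, fun t => ?_, 1 / a, fun t => ?_⟩
  · exact Measurable.ite measurableSet_Ici (by fun_prop) measurable_const
  · unfold expDensity; split_ifs <;> positivity
  · unfold expDensity
    split_ifs with h
    · gcongr
      exact exp_le_one_iff.2 (div_nonpos_of_nonpos_of_nonneg (by linarith) ha.le)
    · positivity

end

/-! ### Log-concavity and its preservation under smoothing. -/

section

/-- A function is totally positive of order two (a multiplicative form of log-concavity). -/
def IsPF2 (f : ℝ → ℝ) : Prop :=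
  ∀ s t δ, s ≤ t → 0 ≤ δ → f s * f (t + δ) ≤ f (s + δ) * f t

lemma IsPF2.comp_neg {f : ℝ → ℝ} (h : IsPF2 f) : IsPF2 (fun x => f (-x)) := by
  intro s t δ hst hδ
  have := h (-(t + δ)) (-(s + δ)) δ (by linarith) hδ
  have e₁ : -(s + δ) + δ = -s := by ring
  have e₂ : -(t + δ) + δ = -t := by ring
  rw [e₁, e₂] at this
  linarith

lemma setIntegral_Ioi_comp_add (g : ℝ → ℝ) (c : ℝ) :
    ∫ x in Ioi c, g x = ∫ x in Ioi 0, g (x + c) := by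
  have := (measurePreserving_add_right volume c).setIntegral_preimage_emb
    (measurableEmbedding_addRight c) g (Ioi c)
  rw [← this]
  simp

lemma expSmooth_neg (a : ℝ) (f : ℝ → ℝ) (t : ℝ) :
    expSmooth (-a) f t = expSmooth a (fun x => f (-x)) (-t) := by
  unfold expSmooth
  refine integral_congr_ae (Filter.Eventually.of_forall fun x => ?_)
  simp only
  congr 2
  ring

namespace IsTame

variable {f : ℝ → ℝ}

/-- The exponential law is memoryless: beyond `x = δ / a` the integral is a scaled copy of the one
at `s`. -/
lemma expSmooth_add (hf : IsTame f) {a : ℝ} (ha : 0 < a) {δ : ℝ} (hδ : 0 ≤ δ) (s : ℝ) :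
    SimplexSection.expSmooth a f (s + δ) =
      (∫ x in Ioc 0 (δ / a), exp (-x) * f (s + δ - a * x)) +
        exp (-(δ / a)) * SimplexSection.expSmooth a f s := by
  have h0 : 0 ≤ δ / a := by positivity
  have hI := hf.integrableOn_shift a (s + δ)
  rw [SimplexSection.expSmooth, ← Ioc_union_Ioi_eq_Ioi h0,
    setIntegral_union (Ioc_disjoint_Ioi le_rfl) measurableSet_Ioi
      (hI.mono_set Ioc_subset_Ioi_self) (hI.mono_set (Ioi_subset_Ioi h0)),
    setIntegral_Ioi_comp_add _ (δ / a), SimplexSection.expSmooth, ← integral_const_mul]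
  congr 1
  refine integral_congr_ae (Filter.Eventually.of_forall fun x => ?_)
  simp only
  rw [neg_add, exp_add, mul_comm (exp (-x)), mul_assoc]
  congr 3
  field_simp
  ring

/-- After `expSmooth_add` the products of tails cancel. What remains compares two double integrals
in `x ≤ δ / a` and `w > 0`, and holds pointwise by log-concavity of `f` at `s - a w`, `t - a w` with
increment `δ - a x + a w ≥ 0`. -/
lemma isPF2_expSmooth_of_pos (hf : IsTame f) (h : IsPF2 f) {a : ℝ} (ha : 0 < a) :
    IsPF2 (SimplexSection.expSmooth a f) := by
  intro s t δ hst hδ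
  rw [hf.expSmooth_add ha hδ s, hf.expSmooth_add ha hδ t]
  have h0 : 0 ≤ δ / a := by positivity
  set H := SimplexSection.expSmooth a f with hH
  suffices (∫ x in Ioc 0 (δ / a), exp (-x) * f (t + δ - a * x)) * H s ≤
      (∫ x in Ioc 0 (δ / a), exp (-x) * f (s + δ - a * x)) * H t by nlinarith
  rw [← integral_mul_const, ← integral_mul_const]
  refine setIntegral_mono_on
    (((hf.integrableOn_shift a _).mono_set Ioc_subset_Ioi_self).mul_const _)
    (((hf.integrableOn_shift a _).mono_set Ioc_subset_Ioi_self).mul_const _)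
    measurableSet_Ioc fun x hx => ?_
  rw [mul_assoc, mul_assoc]
  refine mul_le_mul_of_nonneg_left ?_ (exp_pos _).le
  rw [hH, SimplexSection.expSmooth, SimplexSection.expSmooth, ← integral_const_mul,
    ← integral_const_mul]
  refine setIntegral_mono_on ((hf.integrableOn_shift a s).const_mul _)
    ((hf.integrableOn_shift a t).const_mul _) measurableSet_Ioi fun w hw => ?_
  have hax : a * x ≤ δ := by
    have := hx.2
    rwa [le_div_iff₀ ha, mul_comm] at this
  have haw : 0 < a * w := mul_pos ha hw
  have key := h (s - a * w) (t - a * w) (δ - a * x + a * w) (by linarith) (by linarith)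
  have e₁ : t - a * w + (δ - a * x + a * w) = t + δ - a * x := by ring
  have e₂ : s - a * w + (δ - a * x + a * w) = s + δ - a * x := by ring
  rw [e₁, e₂] at key
  have := mul_le_mul_of_nonneg_left key (exp_pos (-w)).le
  linarith

lemma isPF2_expSmooth (hf : IsTame f) (h : IsPF2 f) (a : ℝ) :
    IsPF2 (SimplexSection.expSmooth a f) := by
  rcases lt_trichotomy a 0 with ha | rfl | ha
  · have h2 := ((hf.comp measurable_neg).isPF2_expSmooth_of_pos h.comp_neg
      (neg_pos.2 ha)).comp_neg
    convert h2 using 2 with t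
    rw [← neg_neg a, expSmooth_neg, neg_neg]
  · rwa [expSmooth_zero]
  · exact hf.isPF2_expSmooth_of_pos h ha

end IsTame

lemma isPF2_expDensity {a : ℝ} (ha : 0 < a) : IsPF2 (expDensity a) := by
  intro s t δ hst hδ
  by_cases hs : 0 ≤ s
  · have ht : 0 ≤ t := hs.trans hst
    refine le_of_eq ?_
    simp only [expDensity, hs, ht, add_nonneg hs hδ, add_nonneg ht hδ, if_true]
    rw [div_mul_div_comm, div_mul_div_comm, ← exp_add, ← exp_add]
    congr 2
    ring
  · have : expDensity a s = 0 := if_neg hs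
    rw [this, zero_mul]
    exact mul_nonneg ((isTame_expDensity ha).nonneg _) ((isTame_expDensity ha).nonneg _)

/-- Continuous positive bounded log-concave functions on the line. -/
structure IsLogConcave (f : ℝ → ℝ) : Prop where
  tame : IsTame f
  pf2 : IsPF2 f
  continuous : Continuous f
  pos : ∀ t, 0 < f t

lemma IsLogConcave.expSmooth {f : ℝ → ℝ} (hf : IsLogConcave f) (a : ℝ) :
    IsLogConcave (expSmooth a f) := by
  refine ⟨hf.tame.expSmooth a, hf.tame.isPF2_expSmooth hf.pf2 a, ?_, fun t => ?_⟩
  · obtain ⟨C, hC⟩ := hf.tame.bounded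
    refine continuous_of_dominated (bound := fun x => exp (-x) * C)
      (fun t => (hf.tame.integrableOn_shift a t).aestronglyMeasurable)
      (fun t => Filter.Eventually.of_forall fun x => ?_)
      (integrableOn_exp_neg.mul_const C) (Filter.Eventually.of_forall fun x => ?_)
    · rw [norm_of_nonneg (mul_nonneg (exp_pos _).le (hf.tame.nonneg _))]
      exact mul_le_mul_of_nonneg_left (hC _) (exp_pos _).le
    · exact continuous_const.mul (hf.continuous.comp (by fun_prop))
  · have hp : ∀ x, 0 < exp (-x) * f (t - a * x) := fun x => mul_pos (exp_pos _) (hf.pos _)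
    rw [SimplexSection.expSmooth, integral_pos_iff_support_of_nonneg (fun x => (hp x).le)
      (hf.tame.integrableOn_shift a t)]
    have : Function.support (fun x => exp (-x) * f (t - a * x)) = univ :=
      eq_univ_of_forall fun x => (hp x).ne'
    rw [this]
    simp

lemma IsLogConcave.foldr {f : ℝ → ℝ} (hf : IsLogConcave f) (l : List ℝ) :
    IsLogConcave (l.foldr SimplexSection.expSmooth f) := by
  induction l with
  | nil => exact hf
  | cons a l ih => exact ih.expSmooth a

lemma integral_exp_neg_mul_Ioi_zero {c : ℝ} (hc : 0 < c) :
    ∫ x in Ioi 0, exp (-(c * x)) = 1 / c := by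
  have := integral_exp_mul_Ioi (a := -c) (by linarith) 0
  simpa [neg_mul, neg_div_neg_eq] using this

/-- The density of the difference of two independent exponential variables. -/
lemma expSmooth_expDensity_of_nonneg {p q : ℝ} (hp : 0 < p) (hq : 0 ≤ q) {t : ℝ} (ht : 0 ≤ t) :
    expSmooth (-q) (expDensity p) t = exp (-t / p) / (p + q) := by
  have h : ∀ x ∈ Ioi (0:ℝ), exp (-x) * expDensity p (t - -q * x) =
      exp (-t / p) / p * exp (-((1 + q / p) * x)) := by
    intro x hx
    have hx' : (0:ℝ) < x := hx
    rw [expDensity, if_pos (by nlinarith), mul_div_assoc', ← exp_add, div_mul_eq_mul_div, ← exp_add]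
    congr 2
    field_simp
    ring
  rw [expSmooth, setIntegral_congr_fun measurableSet_Ioi h, integral_const_mul,
    integral_exp_neg_mul_Ioi_zero (by positivity)]
  field_simp

/-- The integrand vanishes for `x < -t / q`; shifting by this amount pulls out `exp (t / q)` and
leaves the value at 0. -/
lemma expSmooth_expDensity_of_neg {p q : ℝ} (hp : 0 < p) (hq : 0 < q) {t : ℝ} (ht : t < 0) :
    expSmooth (-q) (expDensity p) t = exp (t / q) / (p + q) := by
  have h0 : 0 ≤ -t / q := div_nonneg (by linarith) hq.le
  have hI := (isTame_expDensity hp).integrableOn_shift (-q) t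
  have hz : ∫ x in Ioo 0 (-t / q), exp (-x) * expDensity p (t - -q * x) = 0 := by
    refine setIntegral_eq_zero_of_forall_eq_zero fun x hx => ?_
    have := (lt_div_iff₀ hq).1 hx.2
    rw [expDensity, if_neg (by linarith), mul_zero]
  have hs : Ioi (0 : ℝ) = Ioo 0 (-t / q) ∪ Ici (-t / q) := by
    rw [Ioo_union_Ici_eq_Ioi]
    exact div_pos (by linarith) hq
  have hd : Disjoint (Ioo 0 (-t / q)) (Ici (-t / q)) :=
    Set.disjoint_left.2 fun x hx hx' => not_lt.2 hx' hx.2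
  rw [expSmooth, hs, setIntegral_union hd measurableSet_Ici
    (hI.mono_set Ioo_subset_Ioi_self)
    (hI.mono_set (by rw [hs]; exact subset_union_right)), hz, zero_add, integral_Ici_eq_integral_Ioi,
    setIntegral_Ioi_comp_add]
  have := expSmooth_expDensity_of_nonneg hp hq.le le_rfl
  rw [expSmooth, neg_zero, zero_div, exp_zero] at this
  have h2 : ∀ x : ℝ, exp (-(x + -t / q)) * expDensity p (t - -q * (x + -t / q)) =
      exp (t / q) * (exp (-x) * expDensity p (0 - -q * x)) := by
    intro x
    rw [← mul_assoc, ← exp_add]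
    congr 2
    · ring
    · field_simp
      ring
  simp_rw [h2]
  rw [integral_const_mul, this, mul_one_div]

/-- A single exponential density jumps at 0. One coefficient of each sign gives the continuous tent
`exp (min (-t / p) (t / q)) / (p + q)`, the starting point for all further smoothing. -/
lemma isLogConcave_expSmooth_expDensity {p q : ℝ} (hp : 0 < p) (hq : 0 < q) :
    IsLogConcave (expSmooth (-q) (expDensity p)) := by
  have hT := isTame_expDensity hp
  have key : ∀ t, expSmooth (-q) (expDensity p) t = exp (min (-t / p) (t / q)) / (p + q) := by
    intro t
    rcases lt_or_ge t 0 with ht | ht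
    · rw [expSmooth_expDensity_of_neg hp hq ht, min_eq_right]
      exact (div_neg_of_neg_of_pos ht hq).le.trans (div_nonneg (by linarith) hp.le)
    · rw [expSmooth_expDensity_of_nonneg hp hq.le ht, min_eq_left]
      exact (div_nonpos_of_nonpos_of_nonneg (by linarith) hp.le).trans (div_nonneg ht hq.le)
  refine ⟨hT.expSmooth _, hT.isPF2_expSmooth (isPF2_expDensity hp) _, ?_, fun t => ?_⟩
  · rw [funext key]
    fun_prop
  · rw [key]
    positivity

end

/-! ### Mass, mean and second moment. -/

/-- `f` has total mass one, mean `m` and second moment `v`. -/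
structure HasMoments (f : ℝ → ℝ) (m v : ℝ) : Prop where
  integrable_zero : Integrable f
  integrable_one : Integrable fun t => t * f t
  integrable_two : Integrable fun t => t ^ 2 * f t
  mass : ∫ t, f t = 1
  mean : ∫ t, t * f t = m
  second : ∫ t, t ^ 2 * f t = v

lemma integral_pow_mul_exp_neg_mul {r : ℝ} (hr : 0 < r) (k : ℕ) :
    ∫ t in Ioi 0, t ^ k * exp (-(r * t)) = (1 / r) ^ (k + 1) * (k.factorial : ℝ) := by
  have := integral_rpow_mul_exp_neg_mul_Ioi (a := k + 1) (by positivity) hr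
  rw [Real.Gamma_nat_eq_factorial] at this
  rw [← Real.rpow_natCast (1 / r) (k + 1), Nat.cast_succ, ← this]
  simp

lemma integrableOn_pow_mul_exp_neg_mul {r : ℝ} (hr : 0 < r) (k : ℕ) :
    IntegrableOn (fun t => t ^ k * exp (-(r * t))) (Ioi 0) := by
  -- A non-integrable function has integral 0 by convention, whereas the value just computed is
  -- positive.
  refine not_imp_comm.1 integral_undef ?_
  rw [integral_pow_mul_exp_neg_mul hr]
  positivity

lemma pow_mul_expDensity_ae_eq {p : ℝ} (k : ℕ) :
    (fun t => t ^ k * expDensity p t) =ᵐ[volume]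
      (Ioi 0).indicator fun t => 1 / p * (t ^ k * exp (-(1 / p * t))) := by
  filter_upwards [compl_mem_ae_iff.2 (measure_singleton (μ := volume) (0 : ℝ))] with t ht
  have ht0 : t ≠ 0 := ht
  unfold expDensity
  rw [indicator_apply]
  rcases lt_or_gt_of_ne ht0 with h | h
  · rw [if_neg (not_le.2 h), if_neg (by simpa using h.le), mul_zero]
  · rw [if_pos h.le, if_pos (mem_Ioi.2 h)]
    have : -t / p = -(1 / p * t) := by ring
    rw [this]
    ring

lemma integrable_pow_mul_expDensity {p : ℝ} (hp : 0 < p) (k : ℕ) :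
    Integrable fun t => t ^ k * expDensity p t := by
  refine Integrable.congr ?_ (pow_mul_expDensity_ae_eq k).symm
  rw [integrable_indicator_iff measurableSet_Ioi]
  exact (integrableOn_pow_mul_exp_neg_mul (by positivity) k).const_mul _

lemma integral_pow_mul_expDensity {p : ℝ} (hp : 0 < p) (k : ℕ) :
    ∫ t, t ^ k * expDensity p t = p ^ k * (k.factorial : ℝ) := by
  rw [integral_congr_ae (pow_mul_expDensity_ae_eq k), integral_indicator measurableSet_Ioi,
    integral_const_mul, integral_pow_mul_exp_neg_mul (by positivity)]
  field_simp
  ring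

lemma hasMoments_expDensity {p : ℝ} (hp : 0 < p) : HasMoments (expDensity p) p (2 * p ^ 2) := by
  refine ⟨?_, ?_, integrable_pow_mul_expDensity hp 2, ?_, ?_, ?_⟩
  · simpa using integrable_pow_mul_expDensity hp 0
  · simpa using integrable_pow_mul_expDensity hp 1
  · simpa using integral_pow_mul_expDensity hp 0
  · simpa using integral_pow_mul_expDensity hp 1
  · rw [integral_pow_mul_expDensity hp 2]
    norm_num [mul_comm]

/-- This is the expectation of `φ (Y + a X)` as an integral over the joint law: the shear `(x, t) ↦
(x, t - a x)` preserves the measure, and Fubini does the rest. -/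
lemma integrable_mul_expSmooth {f φ : ℝ → ℝ} (a : ℝ)
    (hG : Integrable (fun z : ℝ × ℝ => φ (z.2 + a * z.1) * (exp (-z.1) * f z.2))
      ((volume.restrict (Ioi 0)).prod volume)) :
    Integrable (fun t => φ t * expSmooth a f t) ∧ ∫ t, φ t * expSmooth a f t =
      ∫ z, φ (z.2 + a * z.1) * (exp (-z.1) * f z.2) ∂((volume.restrict (Ioi 0)).prod volume) := by
  set ν : Measure ℝ := volume.restrict (Ioi 0)
  have hmp : MeasurePreserving (fun z : ℝ × ℝ => (z.1, z.2 - a * z.1)) (ν.prod volume)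
      (ν.prod volume) :=
    (MeasurePreserving.id ν).skew_product (g := fun x t => t - a * x) (by fun_prop)
      (Filter.Eventually.of_forall fun x => map_sub_right_eq_self volume (a * x))
  have h2 : Integrable (fun z : ℝ × ℝ => φ z.2 * (exp (-z.1) * f (z.2 - a * z.1)))
      (ν.prod volume) := by
    have := (hmp.integrable_comp hG.aestronglyMeasurable).2 hG
    simpa [Function.comp_def] using this
  have h3 : ∀ t, φ t * expSmooth a f t = ∫ x, φ t * (exp (-x) * f (t - a * x)) ∂ν := fun t => by
    rw [integral_const_mul, expSmooth]
  refine ⟨?_, ?_⟩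
  · simp_rw [h3]
    exact h2.integral_prod_right
  · simp_rw [h3]
    rw [← integral_prod_symm _ h2]
    have := integral_map hmp.aemeasurable (f := fun z : ℝ × ℝ =>
      φ (z.2 + a * z.1) * (exp (-z.1) * f z.2)) (by rw [hmp.map_eq]; exact hG.aestronglyMeasurable)
    rw [hmp.map_eq] at this
    rw [this]
    simp

lemma HasMoments.expSmooth {f : ℝ → ℝ} {m v : ℝ} (h : HasMoments f m v) (a : ℝ) :
    HasMoments (expSmooth a f) (m + a) (v + 2 * a * m + 2 * a ^ 2) := by
  have hi (k : ℕ) : Integrable (fun x : ℝ => x ^ k * exp (-x)) (volume.restrict (Ioi 0)) := by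
    have := integrableOn_pow_mul_exp_neg_mul one_pos k
    simp only [one_mul] at this
    exact this
  have hv (k : ℕ) : ∫ x in Ioi 0, x ^ k * exp (-x) = k.factorial := by
    simpa using integral_pow_mul_exp_neg_mul one_pos k
  have v0 : ∫ x in Ioi 0, exp (-x) = 1 := by simpa using hv 0
  have v1 : ∫ x in Ioi 0, x * exp (-x) = 1 := by simpa using hv 1
  have v2 : ∫ x in Ioi 0, x ^ 2 * exp (-x) = 2 := by simpa using hv 2
  have i0 : Integrable (fun x : ℝ => exp (-x)) (volume.restrict (Ioi 0)) := by simpa using hi 0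
  have i1 : Integrable (fun x : ℝ => x * exp (-x)) (volume.restrict (Ioi 0)) := by
    simpa using hi 1
  have i2 := hi 2
  have e0 : (fun z : ℝ × ℝ => (1 : ℝ) * (exp (-z.1) * f z.2)) =
      fun z => exp (-z.1) * f z.2 := by simp
  have e1 : (fun z : ℝ × ℝ => (z.2 + a * z.1) * (exp (-z.1) * f z.2)) =
      fun z => exp (-z.1) * (z.2 * f z.2) + a * ((z.1 * exp (-z.1)) * f z.2) := by
    ext z; ring
  have e2 : (fun z : ℝ × ℝ => (z.2 + a * z.1) ^ 2 * (exp (-z.1) * f z.2)) =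
      fun z => exp (-z.1) * (z.2 ^ 2 * f z.2) + 2 * a * ((z.1 * exp (-z.1)) * (z.2 * f z.2)) +
        a ^ 2 * ((z.1 ^ 2 * exp (-z.1)) * f z.2) := by
    ext z; ring
  have m0 := integrable_mul_expSmooth (f := f) (φ := fun _ => 1) a
    (by simp only [e0]; exact i0.mul_prod h.integrable_zero)
  have m1 := integrable_mul_expSmooth (f := f) (φ := fun t => t) a
    (by simp only [e1]; exact (i0.mul_prod h.integrable_one).add
          ((i1.mul_prod h.integrable_zero).const_mul a))
  have m2 := integrable_mul_expSmooth (f := f) (φ := fun t => t ^ 2) a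
    (by simp only [e2]; exact ((i0.mul_prod h.integrable_two).add
          ((i1.mul_prod h.integrable_one).const_mul (2 * a))).add
          ((i2.mul_prod h.integrable_zero).const_mul (a ^ 2)))
  refine ⟨by simpa using m0.1, m1.1, m2.1, ?_, m1.2.trans ?_, m2.2.trans ?_⟩
  · have := m0.2
    simp only [one_mul] at this
    rw [this, integral_prod_mul (fun x => exp (-x)) f, v0, h.mass, one_mul]
  · simp only [e1]
    rw [integral_add (i0.mul_prod h.integrable_one) ((i1.mul_prod h.integrable_zero).const_mul a),
      integral_const_mul, integral_prod_mul (fun x => exp (-x)) (fun t => t * f t),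
      integral_prod_mul (fun x => x * exp (-x)) f, v0, v1, h.mass, h.mean]
    ring
  · simp only [e2]
    rw [integral_add (f := fun z : ℝ × ℝ =>
          exp (-z.1) * (z.2 ^ 2 * f z.2) + 2 * a * ((z.1 * exp (-z.1)) * (z.2 * f z.2)))
          ((i0.mul_prod h.integrable_two).add
          ((i1.mul_prod h.integrable_one).const_mul (2 * a)))
          ((i2.mul_prod h.integrable_zero).const_mul (a ^ 2)),
      integral_add (i0.mul_prod h.integrable_two)
          ((i1.mul_prod h.integrable_one).const_mul (2 * a)),
      integral_const_mul, integral_const_mul,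
      integral_prod_mul (fun x => exp (-x)) (fun t => t ^ 2 * f t),
      integral_prod_mul (fun x => x * exp (-x)) (fun t => t * f t),
      integral_prod_mul (fun x => x ^ 2 * exp (-x)) f, v0, v1, v2, h.mass, h.mean, h.second]
    ring

/-- The variance of a sum of independent variables is the sum of the variances. -/
lemma HasMoments.foldr {f : ℝ → ℝ} {m w : ℝ} (h : HasMoments f m (m ^ 2 + w)) (l : List ℝ) :
    HasMoments (l.foldr SimplexSection.expSmooth f) (m + l.sum)
      ((m + l.sum) ^ 2 + (w + (l.map fun a => a ^ 2).sum)) := by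
  induction l with
  | nil => simpa using h
  | cons a l ih =>
    have h₁ : m + (a :: l).sum = m + l.sum + a := by simp; ring
    have h₂ : (m + (a :: l).sum) ^ 2 + (w + ((a :: l).map fun a => a ^ 2).sum) =
        (m + l.sum) ^ 2 + (w + (l.map fun a => a ^ 2).sum) + 2 * a * (m + l.sum) + 2 * a ^ 2 := by
      simp; ring
    rw [h₂, h₁]
    exact ih.expSmooth a

/-! ### The extremal problem for log-concave densities. -/

section

/-- Quasi-concavity. At an interior minimum `m` below `c`, the steps `m ± ε` that just reach the
nearer endpoint satisfy `ψ (m - ε) * ψ (m + ε) ≤ ψ m ^ 2`, although both factors are at least `ψ m`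
and one is strictly larger. -/
lemma IsPF2.le_of_mem_Icc {ψ : ℝ → ℝ} (h : IsPF2 ψ) (hc : Continuous ψ) (hpos : ∀ t, 0 < ψ t)
    {x y u c : ℝ} (hu : u ∈ Icc x y) (hx : c ≤ ψ x) (hy : c ≤ ψ y) : c ≤ ψ u := by
  obtain ⟨m, hm, hmin⟩ := isCompact_Icc.exists_isMinOn ⟨u, hu⟩ hc.continuousOn
  refine le_trans ?_ (hmin hu)
  by_contra! hlt
  have hmx : x < m := lt_of_le_of_ne hm.1 (by rintro rfl; linarith)
  have hmy : m < y := lt_of_le_of_ne hm.2 (by rintro rfl; linarith)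
  have hε : 0 < min (m - x) (y - m) := lt_min (by linarith) (by linarith)
  have h₁ := min_le_left (m - x) (y - m)
  have h₂ := min_le_right (m - x) (y - m)
  set ε := min (m - x) (y - m) with hεdef
  have key := h (m - ε) m ε (by linarith) hε.le
  rw [sub_add_cancel] at key
  have g₁ : ψ m ≤ ψ (m - ε) := hmin ⟨by linarith, by linarith⟩
  have g₂ : ψ m ≤ ψ (m + ε) := hmin ⟨by linarith, by linarith⟩
  have hp := hpos m
  rcases min_choice (m - x) (y - m) with he | he
  · have : m - ε = x := by rw [hεdef, he]; ring
    rw [this] at key g₁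
    nlinarith
  · have : m + ε = y := by rw [hεdef, he]; ring
    rw [this] at key g₂
    nlinarith

namespace IsLogConcave

variable {f : ℝ → ℝ}

lemma comp_neg (hf : IsLogConcave f) : IsLogConcave (fun x => f (-x)) :=
  ⟨hf.tame.comp measurable_neg, hf.pf2.comp_neg, hf.continuous.comp continuous_neg,
    fun _ => hf.pos _⟩

/-- A log-concave function starts above an exponential and crosses it at most once. -/
lemma exists_linear_mul_sub_exp_nonneg (hf : IsLogConcave f) {c : ℝ} (r : ℝ) (hc : c < f 0) :
    ∃ b d : ℝ, 0 < b ∧ 0 ≤ d ∧ ∀ x, 0 ≤ x → 0 ≤ (b - d * x) * (f x - c * exp (-(r * x))) := by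
  have hψc : Continuous fun x => f x * exp (r * x) := hf.continuous.mul (by fun_prop)
  have hψ : IsPF2 fun x => f x * exp (r * x) := by
    intro s t δ hst hδ
    have := mul_le_mul_of_nonneg_right (hf.pf2 s t δ hst hδ) (exp_pos (r * s + r * (t + δ))).le
    have e : exp (r * s + r * (t + δ)) = exp (r * (s + δ)) * exp (r * t) := by
      rw [← exp_add]; ring_nf
    have e' := exp_add (r * s) (r * (t + δ))
    calc f s * exp (r * s) * (f (t + δ) * exp (r * (t + δ)))
        = f s * f (t + δ) * exp (r * s + r * (t + δ)) := by rw [e']; ring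
      _ ≤ _ := this
      _ = _ := by rw [e]; ring
  have hiff : ∀ x, c ≤ f x * exp (r * x) ↔ c * exp (-(r * x)) ≤ f x := fun x => by
    rw [exp_neg, ← div_eq_mul_inv, div_le_iff₀ (exp_pos _)]
  -- Multiplying by an exponential keeps `IsPF2`, so by quasi-concavity `S` is an interval starting
  -- at 0. Its supremum, if finite, is the crossing point.
  set S := {x : ℝ | 0 ≤ x ∧ c ≤ f x * exp (r * x)} with hS
  have hdown : ∀ v ∈ S, ∀ u, 0 ≤ u → u ≤ v → u ∈ S := fun v hv u hu huv =>
    ⟨hu, hψ.le_of_mem_Icc hψc (fun t => mul_pos (hf.pos t) (exp_pos _)) ⟨hu, huv⟩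
      (by simpa using hc.le) hv.2⟩
  by_cases hb : BddAbove S
  · obtain ⟨ε, hε, hεS⟩ : ∃ ε > 0, ε ∈ S := by
      have h0 : ∀ᶠ x in nhds (0 : ℝ), c < f x * exp (r * x) :=
        hψc.continuousAt.eventually_const_lt (by simpa using hc)
      obtain ⟨ε, hε, hball⟩ := Metric.eventually_nhds_iff.1 h0
      refine ⟨ε / 2, by positivity, by positivity, (hball ?_).le⟩
      rw [Real.dist_eq, sub_zero, abs_of_pos (by positivity)]
      linarith
    refine ⟨sSup S, 1, hε.trans_le (le_csSup hb hεS), zero_le_one, fun x hx => ?_⟩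
    rw [one_mul]
    rcases lt_trichotomy x (sSup S) with h | h | h
    · obtain ⟨v, hv, hxv⟩ := exists_lt_of_lt_csSup ⟨ε, hεS⟩ h
      exact mul_nonneg (by linarith)
        (sub_nonneg.2 ((hiff x).1 (hdown v hv x hx hxv.le).2))
    · simp [h]
    · refine mul_nonneg_of_nonpos_of_nonpos (by linarith) (sub_nonpos.2 ?_)
      by_contra! hlt
      exact not_le.2 h (le_csSup hb ⟨hx, (hiff x).2 hlt.le⟩)
  -- No crossing: a constant factor suffices.
  · refine ⟨1, 0, one_pos, le_rfl, fun x hx => ?_⟩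
    obtain ⟨v, hv, hxv⟩ := not_bddAbove_iff.1 hb x
    have := (hiff x).1 (hdown v hv x hx hxv.le).2
    simpa using this

/-- The sharp bound for the value at the origin of a log-concave density with mean `K ∈ [0, 1]`
and variance one. -/
lemma apply_zero_le (hf : IsLogConcave f) {K : ℝ} (h0 : 0 ≤ K) (h1 : K ≤ 1)
    (hm : HasMoments f K (1 + K ^ 2)) : f 0 ≤ 1 / √(2 - K ^ 2) := by
  by_contra! hlt
  have hpos : 0 < 2 - K ^ 2 := by nlinarith
  set R := √(2 - K ^ 2) with hR
  have hRsq : R ^ 2 = 2 - K ^ 2 := sq_sqrt hpos.le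
  have hR0 : 0 < R := sqrt_pos.2 hpos
  have hKR : K ≤ R := by
    apply le_sqrt_of_sq_le
    nlinarith
  -- The comparison variable `p X - q Y` has mean `p - q = K`, variance `p² + q² = (R² + K²) / 2 =
  -- 1`, and density `1 / (p + q) = 1 / R` at 0.
  obtain ⟨p, q, hp, hq, hpq, hpqK⟩ : ∃ p q : ℝ, 0 < p ∧ 0 ≤ q ∧ p + q = R ∧ p - q = K :=
    ⟨(R + K) / 2, (R - K) / 2, by linarith, by linarith, by ring, by ring⟩
  set g := SimplexSection.expSmooth (-q) (expDensity p) with hg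
  have hgm : HasMoments g K (1 + K ^ 2) := by
    have := (hasMoments_expDensity hp).expSmooth (-q)
    convert this using 1
    · linarith
    · have e1 : p = (R + K) / 2 := by linarith
      have e2 : q = (R - K) / 2 := by linarith
      rw [e1, e2]
      nlinarith
  have hgR : ∀ x, 0 ≤ x → g x = 1 / R * exp (-(1 / p * x)) := fun x hx => by
    rw [hg, expSmooth_expDensity_of_nonneg hp hq hx, hpq]
    have : -x / p = -(1 / p * x) := by ring
    rw [this]
    ring
  obtain ⟨b, d, hb, hd, hright⟩ := hf.exists_linear_mul_sub_exp_nonneg (1 / p) hlt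
  obtain ⟨b', d', hb', hd', hleft⟩ : ∃ b' d' : ℝ, 0 < b' ∧ 0 ≤ d' ∧
      ∀ x < 0, 0 ≤ (b' + d' * x) * (f x - g x) := by
    -- `q = 0` occurs exactly for `K = 1`; then `g` vanishes on the negative axis and there is
    -- nothing to cross.
    rcases hq.eq_or_lt with hq0 | hq0
    · refine ⟨1, 0, one_pos, le_rfl, fun x hx => ?_⟩
      have : g x = 0 := by
        rw [hg, ← hq0, neg_zero, expSmooth_zero]
        exact if_neg (not_le.2 hx)
      simpa [this] using (hf.pos x).le
    · obtain ⟨b', d', hb', hd', h⟩ :=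
        hf.comp_neg.exists_linear_mul_sub_exp_nonneg (c := 1 / R) (1 / q) (by simpa using hlt)
      refine ⟨b', d', hb', hd', fun x hx => ?_⟩
      have := h (-x) (by linarith)
      rw [hg, expSmooth_expDensity_of_neg hp hq0 hx, hpq]
      have e : x / q = -(1 / q * -x) := by ring
      rw [neg_neg] at this
      rw [e]
      convert this using 2 <;> ring
  -- The factor belonging to one half-line is positive on the other one, so the product of both has
  -- the required sign everywhere.
  have hnonneg : ∀ x, 0 ≤ (b' + d' * x) * (b - d * x) * (f x - g x) := by
    intro x
    rcases lt_or_ge x 0 with hx | hx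
    · have h2 : 0 ≤ b - d * x := by nlinarith
      have := mul_nonneg h2 (hleft x hx)
      linarith
    · have h2 : 0 ≤ b' + d' * x := by positivity
      have h3 := hright x hx
      rw [← hgR x hx] at h3
      have := mul_nonneg h2 h3
      linarith
  have hexp : (fun x => (b' + d' * x) * (b - d * x) * (f x - g x)) = fun x =>
      (b' * b) * (f x - g x) + (d' * b - b' * d) * (x * f x - x * g x) +
        (-(d' * d)) * (x ^ 2 * f x - x ^ 2 * g x) := by
    ext x; ring
  have i0 : Integrable fun x => (b' * b) * (f x - g x) := (hm.integrable_zero.sub hgm.integrable_zero).const_mul (b' * b)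
  have i1 : Integrable fun x => (d' * b - b' * d) * (x * f x - x * g x) :=
    (hm.integrable_one.sub hgm.integrable_one).const_mul (d' * b - b' * d)
  have i2 : Integrable fun x => (-(d' * d)) * (x ^ 2 * f x - x ^ 2 * g x) :=
    (hm.integrable_two.sub hgm.integrable_two).const_mul (-(d' * d))
  have hint : Integrable fun x => (b' + d' * x) * (b - d * x) * (f x - g x) := by
    rw [hexp]; exact (i0.add i1).add i2
  have hzero : ∫ x, (b' + d' * x) * (b - d * x) * (f x - g x) = 0 := by
    have j0 := integral_sub hm.integrable_zero hgm.integrable_zero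
    have j1 := integral_sub hm.integrable_one hgm.integrable_one
    have j2 := integral_sub hm.integrable_two hgm.integrable_two
    rw [hm.mass, hgm.mass, sub_self] at j0
    rw [hm.mean, hgm.mean, sub_self] at j1
    rw [hm.second, hgm.second, sub_self] at j2
    rw [hexp, integral_add (f := fun x => (b' * b) * (f x - g x) +
      (d' * b - b' * d) * (x * f x - x * g x)) (i0.add i1) i2, integral_add i0 i1,
      integral_const_mul, integral_const_mul, integral_const_mul, j0, j1, j2]
    ring
  have hae := (integral_eq_zero_iff_of_nonneg hnonneg hint).1 hzero
  have hcont : Continuous fun x => f x - 1 / R * exp (-(1 / p * x)) :=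
    hf.continuous.sub (by fun_prop)
  have hev : ∀ᶠ x in nhds (0 : ℝ), 0 < f x - 1 / R * exp (-(1 / p * x)) ∧ 0 < b - d * x :=
    (hcont.continuousAt.eventually_const_lt (by simpa using hlt)).and
      ((by fun_prop : Continuous fun x : ℝ => b - d * x).continuousAt.eventually_const_lt
        (by simpa using hb))
  obtain ⟨ε, hε, hball⟩ := Metric.eventually_nhds_iff.1 hev
  -- By continuity the integrand is strictly positive on an interval to the right of 0, while its
  -- zero integral makes it vanish almost everywhere.
  have hnull : volume (Ioo 0 ε) = 0 := by
    refine measure_mono_null (fun x hx => ?_) (ae_iff.1 hae)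
    obtain ⟨h2, h3⟩ := hball (y := x) (by rw [Real.dist_eq, sub_zero, abs_of_pos hx.1]; exact hx.2)
    have h4 : 0 < b' + d' * x := by have := mul_nonneg hd' hx.1.le; linarith
    rw [← hgR x hx.1.le] at h2
    exact (mul_pos (mul_pos h4 h3) h2).ne'
  rw [Real.volume_Ioo, sub_zero, ENNReal.ofReal_eq_zero] at hnull
  linarith

end IsLogConcave

end

/-! ### The function `F` as a density at the origin. -/

lemma expDensity_zero {a : ℝ} : expDensity a 0 = 1 / a := by simp [expDensity]

lemma expSmooth_sum {ι : Type*} (s : Finset ι) (w : ι → ℝ) {f : ι → ℝ → ℝ}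
    (hf : ∀ j ∈ s, IsTame (f j)) (b t : ℝ) :
    expSmooth b (fun t => ∑ j ∈ s, w j * f j t) t = ∑ j ∈ s, w j * expSmooth b (f j) t := by
  simp only [expSmooth, ← integral_const_mul, Finset.mul_sum]
  rw [integral_finsetSum]
  · refine Finset.sum_congr rfl fun j _ => integral_congr_ae (.of_forall fun x => ?_)
    simp only
    ring
  · intro j hj
    have := ((hf j hj).integrableOn_shift b t).const_mul (w j)
    refine Integrable.congr this (.of_forall fun x => ?_)
    simp only
    ring

/-- Partial fractions for two exponential densities; the factors `a` and `b` on the right cancel the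
normalizations of the densities. -/
lemma expSmooth_expDensity_of_pos {a b : ℝ} (ha : 0 < a) (hb : 0 < b) (hab : a ≠ b) (t : ℝ) :
    expSmooth b (expDensity a) t = (a * expDensity a t - b * expDensity b t) / (a - b) := by
  have hab' : a - b ≠ 0 := sub_ne_zero.2 hab
  have hab'' : b - a ≠ 0 := sub_ne_zero.2 hab.symm
  have hI := (isTame_expDensity ha).integrableOn_shift b t
  rcases lt_or_ge t 0 with ht | ht
  · have h : ∀ x ∈ Ioi (0:ℝ), exp (-x) * expDensity a (t - b * x) = 0 := fun x hx => by
      have : 0 < b * x := mul_pos hb hx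
      rw [expDensity, if_neg (by linarith), mul_zero]
    rw [expSmooth, setIntegral_eq_zero_of_forall_eq_zero h, expDensity, expDensity,
      if_neg (not_le.2 ht), if_neg (not_le.2 ht)]
    simp
  · have h0 : 0 ≤ t / b := by positivity
    have hc : b / a - 1 ≠ 0 := by
      rw [div_sub_one ha.ne']
      exact div_ne_zero hab'' ha.ne'
    have h₁ : ∫ x in Ioi (t / b), exp (-x) * expDensity a (t - b * x) = 0 := by
      refine setIntegral_eq_zero_of_forall_eq_zero fun x hx => ?_
      have := (div_lt_iff₀ hb).1 (show t / b < x from hx)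
      rw [expDensity, if_neg (by linarith), mul_zero]
    have h₂ : ∀ x ∈ Ioc 0 (t / b), exp (-x) * expDensity a (t - b * x) =
        exp (-t / a) / a * exp ((b / a - 1) * x) := fun x hx => by
      have := (le_div_iff₀ hb).1 hx.2
      rw [expDensity, if_pos (by linarith), mul_div_assoc', ← exp_add, div_mul_eq_mul_div,
        ← exp_add]
      congr 2
      field_simp
      ring
    have h₃ : ∫ x in (0:ℝ)..(t / b), exp ((b / a - 1) * x) =
        (exp (t / a) * exp (-t / b) - 1) / (b / a - 1) := by
      rw [intervalIntegral.integral_comp_mul_left (fun x => exp x) hc, integral_exp, mul_zero,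
        exp_zero, smul_eq_mul, ← exp_add, inv_mul_eq_div]
      congr 3
      field_simp
      ring
    rw [expSmooth, ← Ioc_union_Ioi_eq_Ioi h0,
      setIntegral_union (Ioc_disjoint_Ioi le_rfl) measurableSet_Ioi
        (hI.mono_set Ioc_subset_Ioi_self) (hI.mono_set (Ioi_subset_Ioi h0)), h₁, add_zero,
      setIntegral_congr_fun measurableSet_Ioc h₂, integral_const_mul,
      ← intervalIntegral.integral_of_le h0, h₃, expDensity, expDensity, if_pos ht, if_pos ht]
    have e : exp (-(t / a)) * exp (t / a) = 1 := by
      rw [← exp_add, neg_add_cancel, exp_zero]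
    rw [neg_div, neg_div]
    field_simp
    linear_combination (a - b) * exp (-(t / b)) * e

/-- The products are the Lagrange basis polynomials for the nodes `1 / a j`, evaluated at 0, and
these polynomials sum to 1. -/
lemma sum_prod_inv_one_sub_div {ι : Type*} [DecidableEq ι] {s : Finset ι} (hs : s.Nonempty)
    {a : ι → ℝ} (ha : ∀ j ∈ s, 0 < a j) (hinj : Set.InjOn a s) :
    ∑ j ∈ s, ∏ k ∈ s.erase j, 1 / (1 - a k / a j) = 1 := by
  have hv : Set.InjOn (fun j => 1 / a j) s := fun i hi j hj h => hinj hi hj (by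
    simpa using h)
  have h := congrArg (Polynomial.eval 0) (Lagrange.sum_basis hv hs)
  rw [Polynomial.eval_finsetSum, Polynomial.eval_one] at h
  refine Eq.trans (Finset.sum_congr rfl fun j hj => ?_) h
  rw [Lagrange.basis, Polynomial.eval_prod]
  refine Finset.prod_congr rfl fun k hk => ?_
  have hk' := Finset.mem_erase.1 hk
  have h1 := ha j hj
  have h2 := ha k hk'.2
  have h3 : a j ≠ a k := fun h => hk'.1 (hinj hk'.2 hj h.symm)
  have h4 : a j - a k ≠ 0 := sub_ne_zero.2 h3
  have h5 : a k - a j ≠ 0 := sub_ne_zero.2 h3.symm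
  simp only [Lagrange.basisDivisor, Polynomial.eval_mul, Polynomial.eval_C, Polynomial.eval_sub,
    Polynomial.eval_X]
  have e1 : 1 - a k / a j = (a j - a k) / a j := by field_simp
  have e2 : 1 / a j - 1 / a k = (a k - a j) / (a j * a k) := by field_simp
  rw [e1, e2]
  field_simp
  ring

/-- Partial fractions by induction. A new coefficient `b` splits every old term in two. The pieces
multiplying `expDensity (a b)` add up to the correct weight because the weights sum to 1 both with
and without `b` (`sum_prod_inv_one_sub_div`). -/
lemma foldr_expSmooth_of_pos {ι : Type*} [DecidableEq ι] {a : ι → ℝ} {i : ι} (l : List ι)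
    (hnd : (i :: l).Nodup) (ha : ∀ j ∈ i :: l, 0 < a j)
    (hinj : ∀ j ∈ i :: l, ∀ k ∈ i :: l, a j = a k → j = k) :
    (l.map a).foldr expSmooth (expDensity (a i)) = fun t => ∑ j ∈ (i :: l).toFinset,
      (∏ k ∈ (i :: l).toFinset.erase j, 1 / (1 - a k / a j)) * expDensity (a j) t := by
  induction l with
  | nil => simp
  | cons b l ih =>
    have hsub : ∀ j ∈ i :: l, j ∈ i :: b :: l := fun j hj => by
      rcases List.mem_cons.1 hj with h | h <;> simp [h]
    have hbS : b ∉ (i :: l).toFinset := by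
      simp only [List.nodup_cons, List.mem_cons, not_or, List.mem_toFinset] at hnd ⊢
      exact ⟨fun h => hnd.1.1 h.symm, hnd.2.1⟩
    have hnd' : (i :: l).Nodup := by
      simp only [List.nodup_cons, List.mem_cons, not_or] at hnd ⊢
      exact ⟨hnd.1.2, hnd.2.2⟩
    have hins : (i :: b :: l).toFinset = insert b (i :: l).toFinset := by
      simp [Finset.insert_comm]
    have hsum := sum_prod_inv_one_sub_div (s := (i :: b :: l).toFinset) (a := a) ⟨i, by simp⟩
      (fun j hj => ha j (List.mem_toFinset.1 hj))
      (fun j hj k hk h => hinj j (List.mem_toFinset.1 hj) k (List.mem_toFinset.1 hk) h)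
    rw [List.map_cons, List.foldr_cons, ih hnd' (fun j hj => ha j (hsub j hj))
      (fun j hj k hk => hinj j (hsub j hj) k (hsub k hk))]
    funext t
    rw [hins] at hsum ⊢
    set S := (i :: l).toFinset with hS
    have hSpos : ∀ j ∈ S, 0 < a j := fun j hj => ha j (hsub j (List.mem_toFinset.1 hj))
    have hbpos : 0 < a b := ha b (by simp)
    have hne : ∀ j ∈ S, a j ≠ a b := fun j hj h => hbS (by
      rw [← hinj j (hsub j (List.mem_toFinset.1 hj)) b (by simp) h]; exact hj)
    rw [expSmooth_sum S _ fun j hj => isTame_expDensity (hSpos j hj)]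
    rw [Finset.sum_insert hbS, Finset.erase_insert hbS] at hsum ⊢
    have hw : ∀ j ∈ S, ∏ k ∈ (insert b S).erase j, 1 / (1 - a k / a j) =
        (∏ k ∈ S.erase j, 1 / (1 - a k / a j)) * (1 / (1 - a b / a j)) := fun j hj => by
      have hbj : b ≠ j := fun h => hbS (h ▸ hj)
      rw [Finset.erase_insert_of_ne hbj, Finset.prod_insert (fun h => hbS (Finset.mem_of_mem_erase h)),
        mul_comm]
    have hsumS := sum_prod_inv_one_sub_div (s := S) (a := a) ⟨i, by simp [hS]⟩ hSpos
      (fun j hj k hk h => hinj j (hsub j (List.mem_toFinset.1 hj)) k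
        (hsub k (List.mem_toFinset.1 hk)) h)
    rw [Finset.sum_congr rfl hw] at hsum
    have hR : ∑ j ∈ S, (∏ k ∈ (insert b S).erase j, 1 / (1 - a k / a j)) * expDensity (a j) t =
        ∑ j ∈ S, (∏ k ∈ S.erase j, 1 / (1 - a k / a j)) * (1 / (1 - a b / a j)) *
          expDensity (a j) t := Finset.sum_congr rfl fun j hj => by rw [hw j hj]
    rw [eq_sub_of_add_eq (hsum.trans hsumS.symm), hR, ← Finset.sum_sub_distrib, Finset.sum_mul,
      ← Finset.sum_add_distrib]
    refine Finset.sum_congr rfl fun j hj => ?_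
    rw [expSmooth_expDensity_of_pos (hSpos j hj) hbpos (hne j hj)]
    have h1 := (hSpos j hj).ne'
    have h2 : a j - a b ≠ 0 := sub_ne_zero.2 (hne j hj)
    have e1 : 1 / (1 - a b / a j) = a j / (a j - a b) := by field_simp
    rw [e1]
    field_simp
    ring

/-- For `t ≥ 0` and `a b ≤ 0` the argument `t - a b * x` stays non-negative, where each density is a
pure exponential. Smoothing thus only multiplies it by `1 / (1 - a b / a j)`, with no distinctness
needed. -/
lemma foldr_expSmooth_of_nonpos {ι : Type*} {a : ι → ℝ} (s : Finset ι) (hs : ∀ j ∈ s, 0 < a j)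
    (l : List ι) (hl : ∀ k ∈ l, a k ≤ 0) {w : ι → ℝ} {f : ℝ → ℝ}
    (hf : ∀ t, 0 ≤ t → f t = ∑ j ∈ s, w j * expDensity (a j) t) {t : ℝ} (ht : 0 ≤ t) :
    (l.map a).foldr expSmooth f t =
      ∑ j ∈ s, (w j * (l.map fun k => 1 / (1 - a k / a j)).prod) * expDensity (a j) t := by
  induction l generalizing t with
  | nil => simpa using hf t ht
  | cons b l ih =>
    have hb : a b ≤ 0 := hl b (by simp)
    have ih' : ∀ x ∈ Ioi (0:ℝ), exp (-x) * (l.map a).foldr expSmooth f (t - a b * x) =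
        exp (-x) * (fun u => ∑ j ∈ s, (w j * (l.map fun k => 1 / (1 - a k / a j)).prod) *
          expDensity (a j) u) (t - a b * x) := fun x hx => by
      rw [ih (fun k hk => hl k (List.mem_cons_of_mem _ hk))]
      have := mul_nonneg (neg_nonneg.2 hb) (le_of_lt (show (0:ℝ) < x from hx))
      linarith
    rw [List.map_cons, List.foldr_cons, expSmooth, setIntegral_congr_fun measurableSet_Ioi ih']
    have := expSmooth_sum s (fun j => w j * (l.map fun k => 1 / (1 - a k / a j)).prod)
      (fun j hj => isTame_expDensity (hs j hj)) (a b) t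
    rw [expSmooth] at this
    rw [this]
    refine Finset.sum_congr rfl fun j hj => ?_
    have hj' := hs j hj
    have h2 := expSmooth_expDensity_of_nonneg hj' (neg_nonneg.2 hb) ht
    rw [neg_neg] at h2
    rw [h2, expDensity, if_pos ht, List.map_cons, List.prod_cons]
    have h3 : a j - a b ≠ 0 := by linarith
    have e1 : 1 / (1 - a b / a j) = a j / (a j - a b) := by field_simp
    rw [e1, ← sub_eq_add_neg]
    field_simp

/-- `F a` is the value at the origin of the density of `∑ j, a j X j`. -/
lemma F_eq_foldr {n : ℕ} (a : EuclideanSpace ℝ (Fin (n + 1))) (hd : PosDistinct a)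
    {i : Fin (n + 1)} (hi : 0 < a i) {l : List (Fin (n + 1))} (hl : (i :: l).Nodup)
    (hmem : ∀ k, k ∈ i :: l) : F a = (l.map a).foldr expSmooth (expDensity (a i)) 0 := by
  classical
  set lp := l.filter fun k => 0 < a k with hlp
  set ln := l.filter fun k => ¬ 0 < a k with hln
  -- `foldr` works from the end of the list, so the positive coefficients are applied before the
  -- others.
  have hperm : (ln ++ lp).Perm l := by
    refine List.perm_append_comm.trans ?_
    have := List.filter_append_perm (fun k => decide (0 < a k)) l
    simpa only [hlp, hln, decide_not] using this
  have hndp : (i :: lp).Nodup := hl.sublist (List.Sublist.cons_cons i List.filter_sublist)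
  have hpos : ∀ j ∈ i :: lp, 0 < a j := fun j hj => by
    rcases List.mem_cons.1 hj with rfl | h
    · exact hi
    · simpa using (List.mem_filter.1 h).2
  have hT := isTame_expDensity hi
  rw [← hT.foldr_perm (hperm.map a), List.map_append, List.foldr_append,
    foldr_expSmooth_of_pos lp hndp hpos fun j hj k hk h => hd j k (hpos j hj) (hpos k hk) h,
    foldr_expSmooth_of_nonpos (i :: lp).toFinset (fun j hj => hpos j (List.mem_toFinset.1 hj)) ln
      (fun k hk => by simpa using (List.mem_filter.1 hk).2) (fun t _ => rfl) le_rfl]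
  have hset : (i :: lp).toFinset = Finset.univ.filter fun j => 0 < a j := by
    ext j
    simp only [List.mem_toFinset, Finset.mem_filter, Finset.mem_univ, true_and]
    refine ⟨hpos j, fun h => ?_⟩
    rcases List.mem_cons.1 (hmem j) with rfl | h2
    · simp
    · exact List.mem_cons_of_mem _ (List.mem_filter.2 ⟨h2, by simpa using h⟩)
  have hlnd : ln.Nodup := (List.nodup_cons.1 hl).2.sublist List.filter_sublist
  have hlns : ln.toFinset = Finset.univ.filter fun j => ¬ 0 < a j := by
    ext j
    simp only [hln, List.mem_toFinset, Finset.mem_filter, Finset.mem_univ, true_and,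
      List.mem_filter, decide_eq_true_eq, and_iff_right_iff_imp]
    intro h
    rcases List.mem_cons.1 (hmem j) with rfl | h2
    · exact absurd hi h
    · exact h2
  unfold F
  rw [hset]
  refine Finset.sum_congr (by ext; simp) fun j hj => ?_
  have hj : 0 < a j := by simpa using hj
  rw [← List.prod_toFinset _ hlnd, hlns, expDensity_zero, mul_comm (1 / a j)]
  congr 1
  rw [← Finset.prod_union]
  · refine Finset.prod_congr ?_ fun _ _ => rfl
    ext k
    by_cases hk : k = j
    · subst hk; simp [hj]
    · by_cases h : 0 < a k <;> simp [hk, h, le_of_not_gt]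
  · refine Finset.disjoint_left.2 fun k hk hk' => ?_
    have h1 := (Finset.mem_filter.1 (Finset.mem_of_mem_erase hk)).2
    exact (Finset.mem_filter.1 hk').2 h1

/-! ### From volumes of slices to the density at the origin. -/

section

lemma ofReal_foldr_expSmooth {f : ℝ → ℝ} (hf : IsTame f) {m : ℕ} (c : Fin m → ℝ) (t : ℝ) :
    ENNReal.ofReal ((List.ofFn c).foldr expSmooth f t) =
      ∫⁻ y : Fin m → ℝ, ENNReal.ofReal (exp (-∑ k, y k)) * ENNReal.ofReal (f (t - ∑ k, c k * y k))
        ∂(Measure.pi fun _ => volume.restrict (Ioi 0)) := by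
  induction m generalizing t with
  | zero =>
    rw [Measure.pi_of_empty _ 0, lintegral_dirac]
    simp
  | succ m ih =>
    have hmp := (measurePreserving_piFinSuccAbove
      (fun _ : Fin (m + 1) => (volume.restrict (Ioi 0) : Measure ℝ)) 0).symm
    rw [List.ofFn_succ, List.foldr_cons, (hf.foldr _).ofReal_expSmooth,
      ← hmp.lintegral_comp_emb (MeasurableEquiv.measurableEmbedding _), lintegral_prod]
    · refine lintegral_congr fun x => ?_
      rw [ih, ← lintegral_const_mul' _ _ ENNReal.ofReal_ne_top]
      refine lintegral_congr fun y => ?_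
      simp only [MeasurableEquiv.piFinSuccAbove_symm_apply, Fin.insertNthEquiv,
        Equiv.coe_fn_mk, Fin.insertNth_zero, Fin.sum_univ_succ, Fin.cons_zero, Fin.cons_succ]
      rw [← mul_assoc, ← ENNReal.ofReal_mul (exp_pos _).le, ← exp_add, neg_add, sub_sub]
      rfl
    · refine Measurable.aemeasurable ?_
      refine Measurable.comp (g := fun y : Fin (m + 1) → ℝ => ENNReal.ofReal (exp (-∑ k, y k)) *
        ENNReal.ofReal (f (t - ∑ k, c k * y k))) ?_ (MeasurableEquiv.measurable _)
      exact Measurable.mul (by fun_prop)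
        (hf.measurable.comp (by fun_prop : Measurable fun y : Fin (m + 1) → ℝ =>
          t - ∑ k, c k * y k)).ennreal_ofReal

lemma lintegral_affine {r : ℝ} (hr : r ≠ 0) (d : ℝ) (g : ℝ → ENNReal) :
    ∫⁻ x, g x = ENNReal.ofReal |r| * ∫⁻ x, g (r * x + d) := by
  have h := lintegral_image_eq_lintegral_abs_deriv_mul (s := univ) (f := fun x => r * x + d)
    (f' := fun _ => r) MeasurableSet.univ
    (fun x _ => by
      have := (((hasDerivAt_id' x).const_mul r).add_const d).hasDerivWithinAt (s := univ)
      rwa [mul_one] at this)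
    (fun x _ y _ h => by simpa [hr] using h) g
  have hs : (fun x => r * x + d) '' univ = univ :=
    eq_univ_of_forall fun y => ⟨(y - d) / r, trivial, by field_simp; ring⟩
  rw [hs, setLIntegral_univ, setLIntegral_univ, lintegral_const_mul' _ _ ENNReal.ofReal_ne_top] at h
  exact h

/-- The points `y` of `ℝ^m` which, with `x₀` and `x₁` determined by `x₀ + x₁ + ∑ yₖ = s` and
`α x₀ + β x₁ + ∑ cₖ yₖ = 0`, have `y`, `x₀`, `x₁` non-negative. -/
def slice {m : ℕ} (α β : ℝ) (c : Fin m → ℝ) (s : ℝ) : Set (Fin m → ℝ) :=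
  {y | (∀ k, 0 ≤ y k) ∧ 0 ≤ (-(∑ k, c k * y k) - β * (s - ∑ k, y k)) / (α - β) ∧
    0 ≤ (α * (s - ∑ k, y k) + ∑ k, c k * y k) / (α - β)}

variable {m : ℕ} {α β : ℝ} {c : Fin m → ℝ}

lemma volume_slice {s : ℝ} (hs : 0 < s) :
    volume (slice α β c s) = ENNReal.ofReal (s ^ m) * volume (slice α β c 1) := by
  have h : slice α β c s = (fun y => s⁻¹ • y) ⁻¹' slice α β c 1 := by
    ext y
    simp only [slice, mem_ofPred_eq, mem_preimage, Pi.smul_apply, smul_eq_mul]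
    have e1 : ∑ k, c k * (s⁻¹ * y k) = s⁻¹ * ∑ k, c k * y k := by
      rw [Finset.mul_sum]; exact Finset.sum_congr rfl fun _ _ => by ring
    have hs' := hs.ne'
    have e2 : (-(s⁻¹ * ∑ k, c k * y k) - β * (1 - s⁻¹ * ∑ k, y k)) / (α - β) =
        s⁻¹ * ((-(∑ k, c k * y k) - β * (s - ∑ k, y k)) / (α - β)) := by
      field_simp
    have e3 : (α * (1 - s⁻¹ * ∑ k, y k) + s⁻¹ * ∑ k, c k * y k) / (α - β) =
        s⁻¹ * ((α * (s - ∑ k, y k) + ∑ k, c k * y k) / (α - β)) := by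
      field_simp
    rw [e1, ← Finset.mul_sum, e2, e3]
    simp only [mul_nonneg_iff_of_pos_left (inv_pos.2 hs)]
  rw [h, Measure.addHaar_preimage_smul _ (inv_ne_zero hs.ne')]
  simp [abs_of_pos hs]

lemma slice_of_neg (hαβ : α ≠ β) {s : ℝ} (hs : s < 0) : slice α β c s = ∅ := by
  refine eq_empty_of_forall_notMem fun y hy => ?_
  obtain ⟨h1, h2, h3⟩ := hy
  have h4 := add_nonneg h2 h3
  have h5 : α - β ≠ 0 := sub_ne_zero.2 hαβ
  have e : (-(∑ k, c k * y k) - β * (s - ∑ k, y k)) / (α - β) +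
      (α * (s - ∑ k, y k) + ∑ k, c k * y k) / (α - β) = s - ∑ k, y k := by
    field_simp
    ring
  have := Finset.sum_nonneg fun k (_ : k ∈ Finset.univ) => h1 k
  linarith

lemma measurableSet_slice_prod : MeasurableSet {p : ℝ × (Fin m → ℝ) | p.2 ∈ slice α β c p.1} := by
  have e : {p : ℝ × (Fin m → ℝ) | p.2 ∈ slice α β c p.1} = (⋂ k, {p | 0 ≤ p.2 k}) ∩
      ({p | 0 ≤ (-(∑ k, c k * p.2 k) - β * (p.1 - ∑ k, p.2 k)) / (α - β)} ∩
        {p | 0 ≤ (α * (p.1 - ∑ k, p.2 k) + ∑ k, c k * p.2 k) / (α - β)}) := by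
    ext p
    simp [slice]
  rw [e]
  exact ((isClosed_iInter fun k => isClosed_le continuous_const (by fun_prop)).inter
    ((isClosed_le continuous_const (by fun_prop)).inter
      (isClosed_le continuous_const (by fun_prop)))).measurableSet

/-- The slices scale like `s ^ m` and are empty for `s < 0`, so only the Gamma integral `m!`
appears. -/
lemma lintegral_exp_neg_mul_volume_slice (hαβ : α ≠ β) :
    ∫⁻ s, ENNReal.ofReal (exp (-s)) * volume (slice α β c s) =
      (m.factorial : ENNReal) * volume (slice α β c 1) := by
  have h : ∫⁻ s in Ioi (0:ℝ), ENNReal.ofReal (exp (-s)) * volume (slice α β c s) =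
      (m.factorial : ENNReal) * volume (slice α β c 1) := by
    have h1 : ∀ s ∈ Ioi (0:ℝ), ENNReal.ofReal (exp (-s)) * volume (slice α β c s) =
        ENNReal.ofReal (s ^ m * exp (-(1 * s))) * volume (slice α β c 1) := fun s hs => by
      have hs' : (0:ℝ) < s := hs
      rw [volume_slice hs', ← mul_assoc, ← ENNReal.ofReal_mul (exp_pos _).le, one_mul,
        mul_comm (exp (-s))]
    rw [setLIntegral_congr_fun measurableSet_Ioi h1, lintegral_mul_const _ (by fun_prop),
      ← ofReal_integral_eq_lintegral_ofReal (integrableOn_pow_mul_exp_neg_mul one_pos m),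
      integral_pow_mul_exp_neg_mul one_pos m]
    · simp
    · refine (ae_restrict_mem measurableSet_Ioi).mono fun s hs => ?_
      have hs' : (0:ℝ) < s := hs
      simp only [Pi.zero_apply]
      positivity
  rw [← h, ← lintegral_indicator measurableSet_Ioi]
  refine lintegral_congr_ae ?_
  filter_upwards [compl_mem_ae_iff.2 (measure_singleton (μ := volume) (0 : ℝ))] with s hs
  have hs0 : s ≠ 0 := hs
  rcases lt_or_gt_of_ne hs0 with h | h
  · rw [indicator_of_notMem (by simpa using h.le), slice_of_neg hαβ h]
    simp
  · rw [indicator_of_mem (mem_Ioi.2 h)]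

/-- With `y` fixed, take `w = x₁` as variable instead of the total `s`; then `x₀ = (-τ - β w) / α`
and `s = x₀ + w + σ`. The exponential of `-s` factors, `exp (-x₀)` being `α` times `expDensity α`,
and the Jacobian `|α - β| / α` absorbs this `α`. -/
lemma lintegral_slice_fiber (hα : 0 < α) (hαβ : α ≠ β) {y : Fin m → ℝ} (hy : ∀ k, 0 ≤ y k) :
    ∫⁻ s, {s | y ∈ slice α β c s}.indicator (fun s => ENNReal.ofReal (exp (-s))) s =
      ENNReal.ofReal |α - β| * (ENNReal.ofReal (exp (-∑ k, y k)) *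
        ENNReal.ofReal (expSmooth β (expDensity α) (0 - ∑ k, c k * y k))) := by
  have hT := isTame_expDensity hα
  have h5 : α - β ≠ 0 := sub_ne_zero.2 hαβ
  set σ := ∑ k, y k with hσ
  set τ := ∑ k, c k * y k with hτ
  have hmem : ∀ w, y ∈ slice α β c ((α - β) / α * w + (σ - τ / α)) ↔
      0 ≤ w ∧ 0 ≤ -τ - β * w := by
    intro w
    simp only [slice, mem_ofPred_eq, ← hσ, ← hτ]
    have e1 : (-τ - β * ((α - β) / α * w + (σ - τ / α) - σ)) / (α - β) = (-τ - β * w) / α := by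
      field_simp
      ring
    have e2 : (α * ((α - β) / α * w + (σ - τ / α) - σ) + τ) / (α - β) = w := by
      field_simp
      ring
    rw [e1, e2]
    constructor
    · rintro ⟨_, h1, h2⟩
      exact ⟨h2, by simpa [hα.ne'] using mul_nonneg h1 hα.le⟩
    · rintro ⟨h1, h2⟩
      exact ⟨hy, div_nonneg h2 hα.le, h1⟩
  have hpt : ∀ w, {s | y ∈ slice α β c s}.indicator (fun s => ENNReal.ofReal (exp (-s)))
      ((α - β) / α * w + (σ - τ / α)) = (Ici 0).indicator (fun w => ENNReal.ofReal (α * exp (-σ)) *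
        (ENNReal.ofReal (exp (-w)) * ENNReal.ofReal (expDensity α (0 - τ - β * w)))) w := by
    intro w
    by_cases hw : 0 ≤ w
    · rw [indicator_of_mem (mem_Ici.2 hw)]
      by_cases hz : 0 ≤ -τ - β * w
      · rw [indicator_of_mem (s := {s | y ∈ slice α β c s}) ((hmem w).2 ⟨hw, hz⟩), expDensity,
          if_pos (by linarith), ← ENNReal.ofReal_mul (exp_pos _).le,
          ← ENNReal.ofReal_mul (mul_pos hα (exp_pos _)).le]
        congr 1
        rw [mul_div_assoc', ← exp_add, mul_div_assoc', mul_assoc, ← exp_add,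
          mul_div_cancel_left₀ _ hα.ne']
        congr 1
        field_simp
        ring
      · rw [indicator_of_notMem (s := {s | y ∈ slice α β c s}) (fun h => hz ((hmem w).1 h).2), expDensity,
          if_neg (by simpa using hz)]
        simp
    · rw [indicator_of_notMem (s := {s | y ∈ slice α β c s}) (fun h => hw ((hmem w).1 h).1),
        indicator_of_notMem (by simpa using hw)]
  rw [lintegral_affine (div_ne_zero h5 hα.ne') (σ - τ / α)]
  simp_rw [hpt]
  rw [lintegral_indicator measurableSet_Ici, lintegral_const_mul' _ _ ENNReal.ofReal_ne_top,
    ← restrict_Ioi_eq_restrict_Ici, ← hT.ofReal_expSmooth, ← mul_assoc, ← mul_assoc,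
    ← ENNReal.ofReal_mul (abs_nonneg _), ← ENNReal.ofReal_mul (abs_nonneg _)]
  congr 2
  rw [abs_div, abs_of_pos hα]
  field_simp

/-- Tonelli for `exp (-s)` on the set of pairs `(s, y)` with `y` in the slice: integrating over `y`
first gives the volume, over `s` first the density. -/
lemma factorial_mul_volume_slice (hα : 0 < α) (hαβ : α ≠ β) :
    (m.factorial : ENNReal) * volume (slice α β c 1) = ENNReal.ofReal |α - β| *
      ENNReal.ofReal ((List.ofFn c).foldr expSmooth (expSmooth β (expDensity α)) 0) := by
  set A := {p : ℝ × (Fin m → ℝ) | p.2 ∈ slice α β c p.1} with hA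
  have hAm : MeasurableSet A := measurableSet_slice_prod
  set G : ℝ → (Fin m → ℝ) → ENNReal := fun s y =>
    A.indicator (fun p => ENNReal.ofReal (exp (-p.1))) (s, y) with hG
  have hGm : Measurable (Function.uncurry G) := by
    have : Measurable fun p : ℝ × (Fin m → ℝ) => ENNReal.ofReal (exp (-p.1)) := by fun_prop
    exact this.indicator hAm
  have h1 : ∀ s, ∫⁻ y, G s y = ENNReal.ofReal (exp (-s)) * volume (slice α β c s) := by
    intro s
    have hsm : MeasurableSet (slice α β c s) := measurable_prodMk_left hAm
    rw [← lintegral_indicator_const hsm]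
    rfl
  rw [← lintegral_exp_neg_mul_volume_slice hαβ]
  simp_rw [← h1]
  rw [lintegral_lintegral_swap hGm.aemeasurable, ofReal_foldr_expSmooth
    ((isTame_expDensity hα).expSmooth β), ← lintegral_const_mul' _ _ ENNReal.ofReal_ne_top,
    restrict_Ioi_eq_restrict_Ici, ← Measure.restrict_pi_pi, ← volume_pi,
    ← lintegral_indicator (MeasurableSet.univ_pi fun _ => measurableSet_Ici)]
  refine lintegral_congr fun y => ?_
  by_cases hy : ∀ k, 0 ≤ y k
  · rw [indicator_of_mem (by simpa only [mem_univ_pi, mem_Ici] using hy), ← lintegral_slice_fiber hα hαβ hy]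
    rfl
  · rw [indicator_of_notMem (by simpa only [mem_univ_pi, mem_Ici] using hy)]
    have : ∀ s, G s y = 0 := fun s => 
      indicator_of_notMem (s := A) (fun h => hy (And.left h)) _
    simp [this]

end

/-! ### Sections as graphs and their Hausdorff measure. -/

section

variable {m : ℕ}

/-- The linear embedding `y ↦ (∑ uₖ yₖ, ∑ vₖ yₖ, y)`. -/
def graphMap (u v : Fin m → ℝ) : EuclideanSpace ℝ (Fin m) →ₗ[ℝ] EuclideanSpace ℝ (Fin (m + 2)) where
  toFun y := WithLp.toLp 2 (Fin.cons (∑ k, u k * y k) (Fin.cons (∑ k, v k * y k) fun k => y k))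
  map_add' x y := by
    ext i
    refine Fin.cases ?_ (fun i => Fin.cases ?_ (fun i => ?_) i) i <;>
      simp [mul_add, Finset.sum_add_distrib]
  map_smul' r y := by
    ext i
    refine Fin.cases ?_ (fun i => Fin.cases ?_ (fun i => ?_) i) i <;>
      simp [Finset.mul_sum, mul_left_comm]

lemma graphMap_zero (u v : Fin m → ℝ) (y) : graphMap u v y 0 = ∑ k, u k * y k := rfl

lemma graphMap_one (u v : Fin m → ℝ) (y) : graphMap u v y 1 = ∑ k, v k * y k := rfl

lemma graphMap_succ_succ (u v : Fin m → ℝ) (y) (k : Fin m) :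
    graphMap u v y k.succ.succ = y k := rfl

/-- The Gram matrix is `1 + A Aᵀ` with `A` of size `m × 2`, so its determinant equals that of the 2
× 2 matrix `1 + Aᵀ A`. -/
lemma normDet_graphMap_sq (u v : Fin m → ℝ) :
    (graphMap u v).normDet ^ 2 =
      (1 + ∑ k, u k ^ 2) * (1 + ∑ k, v k ^ 2) - (∑ k, u k * v k) ^ 2 := by
  have h := (graphMap u v).normDet_sq_eq_det_gram (EuclideanSpace.basisFun (Fin m) ℝ)
  simp only [RCLike.ofReal_real_eq_id, id] at h
  rw [h]
  set A : Matrix (Fin m) (Fin 2) ℝ := Matrix.of fun k => ![u k, v k] with hA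
  have hg : Matrix.gram ℝ (fun k => graphMap u v (EuclideanSpace.basisFun (Fin m) ℝ k)) =
      1 + A * A.transpose := by
    ext k l
    rw [Matrix.gram_apply, PiLp.inner_apply, Fin.sum_univ_succ, Fin.sum_univ_succ]
    simp only [Fin.succ_zero_eq_one, graphMap_zero, graphMap_one, graphMap_succ_succ]
    simp [hA, Matrix.mul_apply, Fin.sum_univ_two, Matrix.one_apply]
    ring
  rw [hg, Matrix.det_one_add_mul_comm, Matrix.det_fin_two]
  simp only [hA, Matrix.add_apply, Matrix.mul_apply, Matrix.transpose_apply, Matrix.of_apply,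
    Matrix.one_apply]
  simp only [Matrix.cons_val_zero, Matrix.cons_val_one, if_true, zero_ne_one, one_ne_zero, if_false,
    zero_add, ← pow_two]
  have : ∑ k, v k * u k = ∑ k, u k * v k := Finset.sum_congr rfl fun _ _ => mul_comm _ _
  rw [this]
  ring

/-- The base point of the parametrization of a section by `graphMap`. -/
def graphPoint (m : ℕ) (p q : ℝ) : EuclideanSpace ℝ (Fin (m + 2)) :=
  WithLp.toLp 2 (Fin.cons p (Fin.cons q fun _ => 0))

lemma mem_sec_iff {n : ℕ} (a x : EuclideanSpace ℝ (Fin (n + 1))) :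
    x ∈ sec a ↔ ∑ k, a k * x k = 0 ∧ ∑ k, x k = 1 ∧ ∀ k, 0 ≤ x k := by
  have : inner ℝ a x = ∑ k, a k * x k := by
    rw [PiLp.inner_apply]
    exact Finset.sum_congr rfl fun k _ => by simp [mul_comm]
  simp [sec, hyperplane, simplex, this]

/-- Since `b 0 ≠ b 1`, the two linear equations of the section can be solved for `x 0` and `x 1`;
the remaining coordinates are parameters ranging over the slice. -/
lemma sec_eq_image (b : EuclideanSpace ℝ (Fin (m + 2))) (hb : b 0 ≠ b 1) :
    sec b = (fun x => graphPoint m (-b 1 / (b 0 - b 1)) (b 0 / (b 0 - b 1)) + x) ''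
      (graphMap (fun k => (b 1 - b k.succ.succ) / (b 0 - b 1))
        (fun k => (b k.succ.succ - b 0) / (b 0 - b 1)) ''
        (WithLp.ofLp ⁻¹' slice (b 0) (b 1) (fun k => b k.succ.succ) 1)) := by
  have h : b 0 - b 1 ≠ 0 := sub_ne_zero.2 hb
  have hu : ∀ y : Fin m → ℝ, -b 1 / (b 0 - b 1) + ∑ k, (b 1 - b k.succ.succ) / (b 0 - b 1) * y k =
      (-(∑ k, b k.succ.succ * y k) - b 1 * (1 - ∑ k, y k)) / (b 0 - b 1) := fun y => by
    have : ∑ k, (b 1 - b k.succ.succ) / (b 0 - b 1) * y k =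
        (b 1 * ∑ k, y k - ∑ k : Fin m, b k.succ.succ * y k) / (b 0 - b 1) := by
      rw [Finset.mul_sum, ← Finset.sum_sub_distrib, Finset.sum_div]
      exact Finset.sum_congr rfl fun k _ => by ring
    rw [this]; ring
  have hv : ∀ y : Fin m → ℝ, b 0 / (b 0 - b 1) + ∑ k, (b k.succ.succ - b 0) / (b 0 - b 1) * y k =
      (b 0 * (1 - ∑ k, y k) + ∑ k, b k.succ.succ * y k) / (b 0 - b 1) := fun y => by
    have : ∑ k, (b k.succ.succ - b 0) / (b 0 - b 1) * y k =
        (∑ k : Fin m, b k.succ.succ * y k - b 0 * ∑ k, y k) / (b 0 - b 1) := by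
      rw [Finset.mul_sum, ← Finset.sum_sub_distrib, Finset.sum_div]
      exact Finset.sum_congr rfl fun k _ => by ring
    rw [this]; ring
  rw [image_image]
  ext x
  rw [mem_sec_iff, mem_image]
  constructor
  · rintro ⟨h1, h2, h3⟩
    rw [Fin.sum_univ_succ, Fin.sum_univ_succ, Fin.succ_zero_eq_one] at h1 h2
    have e0 : x 0 = (-(∑ k : Fin m, b k.succ.succ * x k.succ.succ) -
        b 1 * (1 - ∑ k : Fin m, x k.succ.succ)) / (b 0 - b 1) := by
      rw [eq_div_iff h]
      linear_combination h1 - b 1 * h2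
    have e1 : x 1 = (b 0 * (1 - ∑ k : Fin m, x k.succ.succ) +
        ∑ k : Fin m, b k.succ.succ * x k.succ.succ) / (b 0 - b 1) := by
      rw [eq_div_iff h]
      linear_combination b 0 * h2 - h1
    refine ⟨WithLp.toLp 2 fun k => x k.succ.succ, ⟨fun k => h3 _, ?_, ?_⟩, ?_⟩
    · rw [← e0]; exact h3 0
    · rw [← e1]; exact h3 1
    · ext i
      refine Fin.cases ?_ (fun i => Fin.cases ?_ (fun i => ?_) i) i
      · rw [e0, ← hu]; rfl
      · exact (hv _).trans e1.symm
      · exact zero_add _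
  · rintro ⟨y, ⟨hy, h0, h1⟩, rfl⟩
    rw [← hu] at h0
    rw [← hv] at h1
    set z := graphPoint m (-b 1 / (b 0 - b 1)) (b 0 / (b 0 - b 1)) +
      graphMap (fun k => (b 1 - b k.succ.succ) / (b 0 - b 1))
        (fun k => (b k.succ.succ - b 0) / (b 0 - b 1)) y with hz
    have z0 : z 0 = _ := hu y
    have z1 : z 1 = _ := hv y
    have zk : ∀ k : Fin m, z k.succ.succ = y k := fun k => zero_add _
    refine ⟨?_, ?_, ?_⟩
    · rw [Fin.sum_univ_succ, Fin.sum_univ_succ, Fin.succ_zero_eq_one, z0, z1]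
      simp only [zk]
      field_simp
      ring
    · rw [Fin.sum_univ_succ, Fin.sum_univ_succ, Fin.succ_zero_eq_one, z0, z1]
      simp only [zk]
      field_simp
      ring
    · intro i
      refine Fin.cases h0 (fun i => Fin.cases h1 (fun i => ?_) i) i
      rw [zk]
      exact hy i

lemma norm_sq_eq_sum {ι : Type*} [Fintype ι] (a : EuclideanSpace ℝ ι) :
    ‖a‖ ^ 2 = ∑ k, a k ^ 2 := by
  simp [EuclideanSpace.norm_sq_eq]

/-- The Jacobian of the graph is `√(m + 2 - K²) / |b 0 - b 1|`, using `‖b‖ = 1`; its denominator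
cancels the factor in `factorial_mul_volume_slice`. -/
lemma secVol_eq_of_zero_one (b : EuclideanSpace ℝ (Fin (m + 2))) (hnorm : ‖b‖ = 1) (h0 : 0 < b 0)
    (h01 : b 0 ≠ b 1) :
    secVol b = ENNReal.ofReal (√((m : ℝ) + 2 - (∑ k, b k) ^ 2) / m.factorial *
      (List.ofFn fun k : Fin m => b k.succ.succ).foldr expSmooth
        (expSmooth (b 1) (expDensity (b 0))) 0) := by
  have h : b 0 - b 1 ≠ 0 := sub_ne_zero.2 h01
  have hsq : b 0 ^ 2 + (b 1 ^ 2 + ∑ k : Fin m, b k.succ.succ ^ 2) = 1 := by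
    have := norm_sq_eq_sum b
    rw [hnorm, Fin.sum_univ_succ, Fin.sum_univ_succ, Fin.succ_zero_eq_one] at this
    linarith
  set u : Fin m → ℝ := fun k => (b 1 - b k.succ.succ) / (b 0 - b 1) with hu
  set v : Fin m → ℝ := fun k => (b k.succ.succ - b 0) / (b 0 - b 1) with hv
  have hdet : (graphMap u v).normDet = √((m : ℝ) + 2 - (∑ k, b k) ^ 2) / |b 0 - b 1| := by
    have e : (graphMap u v).normDet ^ 2 = ((m : ℝ) + 2 - (∑ k, b k) ^ 2) / |b 0 - b 1| ^ 2 := by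
      rw [normDet_graphMap_sq, Fin.sum_univ_succ, Fin.sum_univ_succ, Fin.succ_zero_eq_one, sq_abs]
      set C1 := ∑ k : Fin m, b k.succ.succ
      set C2 := ∑ k : Fin m, b k.succ.succ ^ 2
      have e1 : ∑ k, u k ^ 2 = (m * b 1 ^ 2 - 2 * b 1 * C1 + C2) / (b 0 - b 1) ^ 2 := by
        have : ∀ k, u k ^ 2 = (b 1 ^ 2 - 2 * b 1 * b k.succ.succ + b k.succ.succ ^ 2) /
          (b 0 - b 1) ^ 2 := fun k => by
          simp only [hu]; rw [div_pow]; ring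
        simp_rw [this]
        rw [← Finset.sum_div, Finset.sum_add_distrib, Finset.sum_sub_distrib, ← Finset.mul_sum]
        simp [C1, C2]
      have e2 : ∑ k, v k ^ 2 = (m * b 0 ^ 2 - 2 * b 0 * C1 + C2) / (b 0 - b 1) ^ 2 := by
        have : ∀ k, v k ^ 2 = (b 0 ^ 2 - 2 * b 0 * b k.succ.succ + b k.succ.succ ^ 2) /
          (b 0 - b 1) ^ 2 := fun k => by
          simp only [hv]; rw [div_pow]; ring
        simp_rw [this]
        rw [← Finset.sum_div, Finset.sum_add_distrib, Finset.sum_sub_distrib, ← Finset.mul_sum]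
        simp [C1, C2]
      have e3 : ∑ k, u k * v k = ((b 0 + b 1) * C1 - m * (b 0 * b 1) - C2) / (b 0 - b 1) ^ 2 := by
        have : ∀ k, u k * v k = ((b 0 + b 1) * b k.succ.succ - b 0 * b 1 - b k.succ.succ ^ 2) /
          (b 0 - b 1) ^ 2 := fun k => by
          simp only [hu, hv]; rw [div_mul_div_comm, ← pow_two]; ring
        simp_rw [this]
        rw [← Finset.sum_div, Finset.sum_sub_distrib, Finset.sum_sub_distrib, ← Finset.mul_sum]
        simp [C1, C2]
      rw [e1, e2, e3]
      have hC2 : C2 = 1 - b 0 ^ 2 - b 1 ^ 2 := by linarith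
      rw [hC2]
      field_simp
      ring
    have hnn : 0 ≤ (m : ℝ) + 2 - (∑ k, b k) ^ 2 := by
      have := (eq_div_iff (by positivity)).1 e
      rw [← this]
      positivity
    rw [← sqrt_sq (graphMap u v).normDet_nonneg, e, sqrt_div hnn, sqrt_sq (abs_nonneg _)]
  have hvol : volume (WithLp.ofLp ⁻¹' slice (b 0) (b 1) (fun k : Fin m => b k.succ.succ) 1 :
      Set (EuclideanSpace ℝ (Fin m))) = volume (slice (b 0) (b 1) (fun k => b k.succ.succ) 1) :=
    (EuclideanSpace.volume_preserving_symm_measurableEquiv_toLp (Fin m)).measure_preimage_equiv _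
  have hfac := factorial_mul_volume_slice (c := fun k : Fin m => b k.succ.succ) h0 h01
  have himg := (graphMap u v).euclideanHausdorffMeasure_image_eq_normDet_mul_volume
    (WithLp.ofLp ⁻¹' slice (b 0) (b 1) (fun k : Fin m => b k.succ.succ) 1)
  rw [finrank_euclideanSpace_fin, hvol, hdet] at himg
  set f := (List.ofFn fun k : Fin m => b k.succ.succ).foldr expSmooth
        (expSmooth (b 1) (expDensity (b 0)))
  have hm0 : (m.factorial : ENNReal) ≠ 0 := by exact_mod_cast m.factorial_ne_zero
  have hvol' : volume (slice (b 0) (b 1) (fun k => b k.succ.succ) 1) =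
      ENNReal.ofReal (|b 0 - b 1| / m.factorial * f 0) := by
    rw [← ENNReal.mul_right_inj hm0 (ENNReal.natCast_ne_top _), hfac,
      ← ENNReal.ofReal_natCast, ← ENNReal.ofReal_mul (abs_nonneg _),
      ← ENNReal.ofReal_mul (by positivity)]
    congr 1
    have : (m.factorial : ℝ) ≠ 0 := by positivity
    field_simp
  rw [secVol, sec_eq_image b h01, Nat.add_sub_cancel,
    (isometry_add_left _).euclideanHausdorffMeasure_image, himg, hvol', ← ENNReal.ofReal_mul (by positivity)]
  congr 1
  have : |b 0 - b 1| ≠ 0 := abs_ne_zero.2 h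
  field_simp

lemma secVol_comp_perm {n : ℕ} (a : EuclideanSpace ℝ (Fin (n + 1))) (σ : Equiv.Perm (Fin (n + 1))) :
    secVol (WithLp.toLp 2 fun k => a (σ k) : EuclideanSpace ℝ (Fin (n + 1))) = secVol a := by
  have h : sec (WithLp.toLp 2 fun k => a (σ k) : EuclideanSpace ℝ (Fin (n + 1))) =
      LinearIsometryEquiv.piLpCongrLeft 2 ℝ ℝ σ.symm '' sec a := by
    ext x
    rw [LinearIsometryEquiv.image_eq_preimage_symm, mem_preimage, mem_sec_iff, mem_sec_iff]
    have hx : ∀ k, (LinearIsometryEquiv.piLpCongrLeft 2 ℝ ℝ σ.symm).symm x k = x (σ.symm k) := by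
      intro k
      simp [LinearIsometryEquiv.piLpCongrLeft_symm, LinearIsometryEquiv.piLpCongrLeft_apply,
        Equiv.piCongrLeft'_apply]
    simp only [hx]
    have e1 : ∑ k, a k * x (σ.symm k) = ∑ k, a (σ k) * x k := by
      rw [← Equiv.sum_comp σ]; simp
    have e2 : ∑ k, x (σ.symm k) = ∑ k, x k := Equiv.sum_comp σ.symm _
    rw [e1, e2]
    refine and_congr Iff.rfl (and_congr Iff.rfl ?_)
    exact (σ.symm.forall_congr_left (p := fun k => 0 ≤ x (σ.symm k))).trans (by simp) |>.symm
  rw [secVol, h, (LinearIsometryEquiv.isometry _).euclideanHausdorffMeasure_image, secVol]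

end

/-! ### The bounds for the volume and for `F`. -/

section

variable {n : ℕ}

lemma exists_perm_zero_one {m : ℕ} {i j : Fin (m + 2)} (hij : i ≠ j) :
    ∃ σ : Equiv.Perm (Fin (m + 2)), σ 0 = i ∧ σ 1 = j := by
  have h : Equiv.swap 0 i 1 ≠ i := by
    intro h
    have h2 : Equiv.swap 0 i 1 = Equiv.swap 0 i 0 := by rw [h, Equiv.swap_apply_left]
    exact one_ne_zero ((Equiv.swap 0 i).injective h2)
  refine ⟨(Equiv.swap 0 i).trans (Equiv.swap (Equiv.swap 0 i 1) j), ?_, ?_⟩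
  · rw [Equiv.trans_apply, Equiv.swap_apply_left, Equiv.swap_apply_of_ne_of_ne h.symm hij]
  · rw [Equiv.trans_apply, Equiv.swap_apply_left]

/-- The volume of a section in terms of the density at the origin of `∑ j, a j X j`, where the
`X j` are independent standard exponential variables. -/
lemma secVol_eq (hn : 1 ≤ n) (a : EuclideanSpace ℝ (Fin (n + 1))) (hnorm : ‖a‖ = 1)
    {i j : Fin (n + 1)} (hi : 0 < a i) (hij : a i ≠ a j) {l : List (Fin (n + 1))}
    (hl : (i :: l).Nodup) (hmem : ∀ k, k ∈ i :: l) :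
    secVol a = ENNReal.ofReal (√((n : ℝ) + 1 - (∑ k, a k) ^ 2) / ((n - 1).factorial : ℝ) *
      (l.map a).foldr expSmooth (expDensity (a i)) 0) := by
  obtain ⟨m, rfl⟩ : ∃ m, n = m + 1 := ⟨n - 1, by omega⟩
  obtain ⟨σ, rfl, rfl⟩ := exists_perm_zero_one (i := i) (j := j) fun h => hij (congrArg a h)
  set b : EuclideanSpace ℝ (Fin (m + 2)) := WithLp.toLp 2 fun k => a (σ k) with hb
  have hbn : ‖b‖ = 1 := by
    have h1 : ‖b‖ ^ 2 = ‖a‖ ^ 2 := by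
      rw [norm_sq_eq_sum, norm_sq_eq_sum]
      exact Equiv.sum_comp σ fun k => a k ^ 2
    rw [hnorm, one_pow] at h1
    exact (pow_eq_one_iff_of_nonneg (norm_nonneg b) two_ne_zero).1 h1
  have hbs : ∑ k, b k = ∑ k, a k := Equiv.sum_comp σ fun k => a k
  have h := secVol_eq_of_zero_one b hbn hi hij
  rw [hb, secVol_comp_perm, ← hb, hbs] at h
  rw [h, Nat.add_sub_cancel]
  have hcast : ((m + 1 : ℕ) : ℝ) + 1 = m + 2 := by push_cast; ring
  rw [hcast]
  congr 2
  -- `σ 1` stands last because `foldr` applies the last entry first, matching the innermost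
  -- `expSmooth (b 1)`.
  have hnd : ((List.ofFn fun k : Fin m => σ k.succ.succ) ++ [σ 1]).Nodup := by
    refine List.Nodup.append ?_ (by simp) ?_
    · exact List.nodup_ofFn.2 fun x y hxy => by simpa using hxy
    · rw [List.disjoint_singleton]
      intro hx
      obtain ⟨k, hk⟩ := List.mem_ofFn' _ _ |>.1 hx
      have := σ.injective hk
      rw [← Fin.succ_zero_eq_one] at this
      exact Fin.succ_ne_zero _ (Fin.succ_injective _ this)
  have hperm : ((List.ofFn fun k : Fin m => σ k.succ.succ) ++ [σ 1]).Perm l := by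
    refine (List.perm_ext_iff_of_nodup hnd (List.nodup_cons.1 hl).2).2 fun k => ?_
    have hk : k ∈ l ↔ k ≠ σ 0 := by
      refine ⟨fun h h' => (List.nodup_cons.1 hl).1 (h' ▸ h), fun h => ?_⟩
      exact (List.mem_cons.1 (hmem k)).resolve_left h
    rw [hk]
    simp only [List.mem_append, List.mem_ofFn, List.mem_singleton]
    constructor
    · rintro (⟨x, rfl⟩ | rfl) h
      · exact Fin.succ_ne_zero _ (σ.injective h)
      · exact one_ne_zero (σ.injective h)
    · intro h
      obtain ⟨x, rfl⟩ := σ.surjective k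
      induction x using Fin.cases with
      | zero => exact absurd rfl h
      | succ x =>
        induction x using Fin.cases with
        | zero => exact Or.inr rfl
        | succ x => exact Or.inl ⟨x, rfl⟩
  rw [← (isTame_expDensity hi).foldr_perm (hperm.map a), List.map_append, List.foldr_append,
    List.map_ofFn]
  rfl

lemma sum_eq_add_list_sum {ι : Type*} [Fintype ι] (f : ι → ℝ) {i : ι}
    {l : List ι} (hl : (i :: l).Nodup) (hmem : ∀ k, k ∈ i :: l) :
    ∑ k, f k = f i + (l.map f).sum := by
  classical
  have : (Finset.univ : Finset ι) = (i :: l).toFinset := by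
    ext k
    simpa using hmem k
  rw [this, List.sum_toFinset _ hl, List.map_cons, List.sum_cons]

lemma exists_list_cons_nodup (i : Fin (n + 1)) :
    ∃ l : List (Fin (n + 1)), (i :: l).Nodup ∧ ∀ k, k ∈ i :: l :=
  ⟨(Finset.univ.erase i).toList, by simp [Finset.nodup_toList], fun k => by
    by_cases h : k = i <;> simp [h]⟩

/-- Each entry lies in `[0, 1]`, so `a k ^ 2 ≤ a k`, while `∑ a k ≤ 1 = ∑ a k ^ 2`; hence equality
holds termwise. -/
lemma sq_eq_self_of_nonneg {a : EuclideanSpace ℝ (Fin (n + 1))} (hnorm : ‖a‖ = 1)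
    (hs : ∑ k, a k ≤ 1) (h : ∀ k, 0 ≤ a k) (k : Fin (n + 1)) : a k ^ 2 = a k := by
  have h1 := norm_sq_eq_sum a
  rw [hnorm, one_pow] at h1
  have hle : ∀ k ∈ Finset.univ, a k ^ 2 ≤ a k := fun k _ => by
    have h2 := Finset.single_le_sum (f := fun k => a k ^ 2) (fun k _ => sq_nonneg _)
      (Finset.mem_univ k)
    have h3 := h k
    simp only at h2
    nlinarith
  exact (Finset.sum_eq_sum_iff_of_le hle).1 (le_antisymm (Finset.sum_le_sum hle)
    (by rw [← h1]; exact hs)) k (Finset.mem_univ k)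

lemma exists_pos_of_sum_nonneg {a : EuclideanSpace ℝ (Fin (n + 1))} (hnorm : ‖a‖ = 1)
    (hs : 0 ≤ ∑ k, a k) : ∃ i, 0 < a i := by
  by_contra! h
  have h0 : ∑ k, a k = 0 := le_antisymm (Finset.sum_nonpos fun k _ => h k) hs
  have hz := (Finset.sum_eq_zero_iff_of_nonpos fun k _ => h k).1 h0
  have h1 := norm_sq_eq_sum a
  rw [hnorm, Finset.sum_eq_zero fun k hk => by rw [hz k hk]; norm_num] at h1
  norm_num at h1

lemma exists_nonpos_of_sum_le_one (hn : 1 ≤ n) {a : EuclideanSpace ℝ (Fin (n + 1))}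
    (hnorm : ‖a‖ = 1) (hs : ∑ k, a k ≤ 1) : ∃ j, a j ≤ 0 := by
  by_contra! h
  have h1 : ∀ k, a k = 1 := fun k => by
    have := sq_eq_self_of_nonneg hnorm hs (fun k => (h k).le) k
    have h2 := h k
    nlinarith
  have h2 := hs
  simp only [h1, Finset.sum_const, Finset.card_univ, Fintype.card_fin, nsmul_eq_mul] at h2
  have : (1:ℝ) ≤ n := by exact_mod_cast hn
  push_cast at h2
  linarith

/-- If some entry is negative, applying it first makes the density an `IsLogConcave` function with
mean `K` and variance 1, and `apply_zero_le` applies. Otherwise `a` is a standard basis vector, `K =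
1`, and the density is that of one exponential variable, with value 1 at 0. -/
lemma foldr_expSmooth_le {a : EuclideanSpace ℝ (Fin (n + 1))} (hnorm : ‖a‖ = 1)
    (h0 : 0 ≤ ∑ k, a k) (h1 : ∑ k, a k ≤ 1) {i : Fin (n + 1)} (hi : 0 < a i)
    {l : List (Fin (n + 1))} (hl : (i :: l).Nodup) (hmem : ∀ k, k ∈ i :: l) :
    (l.map a).foldr expSmooth (expDensity (a i)) 0 ≤ 1 / √(2 - (∑ k, a k) ^ 2) := by
  have hsq := norm_sq_eq_sum a
  rw [hnorm, one_pow] at hsq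
  by_cases hneg : ∃ j, a j < 0
  · obtain ⟨j, hj⟩ := hneg
    have hjl : j ∈ l := (List.mem_cons.1 (hmem j)).resolve_left fun h => by
      rw [h] at hj; linarith
    have hT := isTame_expDensity hi
    have hperm : (l.erase j ++ [j]).Perm l :=
      List.perm_append_comm.trans (List.perm_cons_erase hjl).symm
    have hlc : IsLogConcave ((l.map a).foldr expSmooth (expDensity (a i))) := by
      rw [← hT.foldr_perm (hperm.map a), List.map_append, List.foldr_append]
      refine IsLogConcave.foldr ?_ _
      have := isLogConcave_expSmooth_expDensity hi (neg_pos.2 hj)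
      rwa [neg_neg] at this
    refine hlc.apply_zero_le h0 h1 ?_
    have hm : HasMoments (expDensity (a i)) (a i) (a i ^ 2 + a i ^ 2) := by
      have := hasMoments_expDensity hi
      rwa [two_mul] at this
    have := hm.foldr (l.map a)
    rw [← sum_eq_add_list_sum (fun k => a k) hl hmem, List.map_map] at this
    have h2 := sum_eq_add_list_sum (fun k => a k ^ 2) hl hmem
    rw [← hsq] at h2
    have e : (l.map ((fun x => x ^ 2) ∘ a)).sum = (l.map fun k => a k ^ 2).sum := rfl
    rw [e, ← h2, add_comm _ (1 : ℝ)] at this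
    exact this
  · push Not at hneg
    have hid := sq_eq_self_of_nonneg hnorm h1 hneg
    have hi1 : a i = 1 := by have := hid i; nlinarith
    have hz : ∀ k ∈ l, a k = 0 := fun k hk => by
      have hki : k ≠ i := fun h => (List.nodup_cons.1 hl).1 (h ▸ hk)
      have h2 := Finset.add_le_sum (f := fun k => a k ^ 2) (s := Finset.univ)
        (fun k _ => sq_nonneg _) (Finset.mem_univ k) (Finset.mem_univ i) hki
      simp only [← hsq, hi1] at h2
      have : a k ^ 2 = 0 := le_antisymm (by linarith) (sq_nonneg _)
      exact pow_eq_zero_iff two_ne_zero |>.1 this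
    have hsum : ∑ k, a k = 1 := by
      rw [hsq]; exact Finset.sum_congr rfl fun k _ => (hid k).symm
    have hf : ∀ l' : List (Fin (n + 1)), (∀ k ∈ l', a k = 0) →
        (l'.map a).foldr expSmooth (expDensity (a i)) = expDensity (a i) := by
      intro l' h
      induction l' with
      | nil => rfl
      | cons b l' ih =>
        rw [List.map_cons, List.foldr_cons, ih fun k hk => h k (List.mem_cons_of_mem _ hk),
          h b (by simp), expSmooth_zero]
    rw [hf l hz, hsum, expDensity_zero, hi1]
    norm_num

/-- The sharp upper bound for the volume of sections by hyperplanes with coordinate sum `K`. -/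
def volBound (n : ℕ) (K : ℝ) : ℝ :=
  √((n : ℝ) + 1 - K ^ 2) / (Nat.factorial (n - 1) : ℝ) * (1 / √(2 - K ^ 2))

lemma volBound_neg (n : ℕ) (K : ℝ) : volBound n (-K) = volBound n K := by
  simp [volBound]

lemma volBound_congr {K K' : ℝ} (h : K ^ 2 = K' ^ 2) : volBound n K = volBound n K' := by
  rw [volBound, volBound, h]

lemma secVol_neg (a : EuclideanSpace ℝ (Fin (n + 1))) : secVol (-a) = secVol a := by
  have : sec (-a) = sec a := by
    ext x
    simp [mem_sec_iff]
  rw [secVol, this, secVol]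

lemma sum_neg_apply (a : EuclideanSpace ℝ (Fin (n + 1))) : ∑ k, (-a) k = -∑ k, a k := by
  simp

lemma secVol_le (hn : 1 ≤ n) {a : EuclideanSpace ℝ (Fin (n + 1))} (hnorm : ‖a‖ = 1)
    (hs : (∑ k, a k) ^ 2 ≤ 1) : secVol a ≤ ENNReal.ofReal (volBound n (∑ k, a k)) := by
  -- `a` and `-a` define the same section.
  wlog h0 : 0 ≤ ∑ k, a k generalizing a
  · have := this (a := -a) (by rwa [norm_neg]) (by rwa [sum_neg_apply, neg_sq])
      (by rw [sum_neg_apply]; linarith)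
    rwa [secVol_neg, sum_neg_apply, volBound_neg] at this
  have h1 : ∑ k, a k ≤ 1 := by nlinarith
  obtain ⟨i, hi⟩ := exists_pos_of_sum_nonneg hnorm h0
  obtain ⟨j, hj⟩ := exists_nonpos_of_sum_le_one hn hnorm h1
  obtain ⟨l, hl, hmem⟩ := exists_list_cons_nodup i
  rw [secVol_eq hn a hnorm hi (hj.trans_lt hi).ne' hl hmem]
  refine ENNReal.ofReal_le_ofReal (mul_le_mul_of_nonneg_left ?_ (by positivity))
  exact foldr_expSmooth_le hnorm h0 h1 hi hl hmem

lemma F_le {a : EuclideanSpace ℝ (Fin (n + 1))} (hnorm : ‖a‖ = 1)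
    (h0 : 0 ≤ ∑ k, a k) (h1 : ∑ k, a k ≤ 1) (hd : PosDistinct a) :
    F a ≤ 1 / √(2 - (∑ k, a k) ^ 2) := by
  obtain ⟨i, hi⟩ := exists_pos_of_sum_nonneg hnorm h0
  obtain ⟨l, hl, hmem⟩ := exists_list_cons_nodup i
  rw [F_eq_foldr a hd hi hl hmem]
  exact foldr_expSmooth_le hnorm h0 h1 hi hl hmem

/-! ### The case of equality. -/

section Extremal

variable {K : ℝ} {i j : Fin (n + 1)}

lemma extremal_left (hij : i ≠ j) : extremal n K i j i = K / 2 + √(1 / 2 - K ^ 2 / 4) := by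
  simp [extremal, hij]

lemma extremal_right (hij : i ≠ j) : extremal n K i j j = K / 2 - √(1 / 2 - K ^ 2 / 4) := by
  simp [extremal, hij.symm]

lemma extremal_of_ne {k : Fin (n + 1)} (hi : k ≠ i) (hj : k ≠ j) : extremal n K i j k = 0 := by
  simp [extremal, hi, hj]

lemma sum_eq_of_support {f : Fin (n + 1) → ℝ} (hij : i ≠ j) (h : ∀ k, k ≠ i → k ≠ j → f k = 0) :
    ∑ k, f k = f i + f j :=
  Fintype.sum_eq_add i j hij fun k hk => h k hk.1 hk.2

lemma mem_hyperplane_vertex (a : EuclideanSpace ℝ (Fin (n + 1))) (k : Fin (n + 1)) :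
    vertex n k ∈ hyperplane a ↔ a k = 0 := by
  simp [vertex, hyperplane, EuclideanSpace.inner_single_right]

lemma extremal_sq (h0 : 0 ≤ K) (h1 : K ≤ 1) : √(1 / 2 - K ^ 2 / 4) ^ 2 = 1 / 2 - K ^ 2 / 4 :=
  sq_sqrt (by nlinarith)

lemma sum_extremal (hij : i ≠ j) : ∑ k, extremal n K i j k = K := by
  rw [sum_eq_of_support hij fun k => extremal_of_ne, extremal_left hij, extremal_right hij]
  ring

lemma norm_extremal (h0 : 0 ≤ K) (h1 : K ≤ 1) (hij : i ≠ j) : ‖extremal n K i j‖ = 1 := by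
  have h := norm_sq_eq_sum (extremal n K i j)
  rw [sum_eq_of_support hij fun k hi hj => by rw [extremal_of_ne hi hj]; norm_num,
    extremal_left hij, extremal_right hij] at h
  have h2 := extremal_sq h0 h1
  have h3 : ‖extremal n K i j‖ ^ 2 = 1 := by rw [h]; nlinarith
  exact (pow_eq_one_iff_of_nonneg (norm_nonneg _) two_ne_zero).1 h3

lemma extremal_left_pos (h0 : 0 ≤ K) (h1 : K ≤ 1) (hij : i ≠ j) : 0 < extremal n K i j i := by
  rw [extremal_left hij]
  have : 0 < √(1 / 2 - K ^ 2 / 4) := sqrt_pos.2 (by nlinarith)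
  linarith

lemma extremal_nonpos (h0 : 0 ≤ K) (h1 : K ≤ 1) (hij : i ≠ j) {k : Fin (n + 1)} (hk : k ≠ i) :
    extremal n K i j k ≤ 0 := by
  by_cases h : k = j
  · rw [h, extremal_right hij]
    have : K / 2 ≤ √(1 / 2 - K ^ 2 / 4) := le_sqrt_of_sq_le (by nlinarith)
    linarith
  · exact (extremal_of_ne hk h).le

lemma eq_left_of_extremal_pos (h0 : 0 ≤ K) (h1 : K ≤ 1) (hij : i ≠ j) {k : Fin (n + 1)}
    (hk : 0 < extremal n K i j k) : k = i := by
  by_contra h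
  exact not_lt.2 (extremal_nonpos h0 h1 hij h) hk

lemma posDistinct_extremal (h0 : 0 ≤ K) (h1 : K ≤ 1) (hij : i ≠ j) :
    PosDistinct (extremal n K i j) := fun _ _ hk hl _ =>
  (eq_left_of_extremal_pos h0 h1 hij hk).trans (eq_left_of_extremal_pos h0 h1 hij hl).symm

/-- Only entry `i` is positive and only `j` contributes a nontrivial factor, which leaves the
reciprocal of the difference of the two entries, `2 √(1/2 - K²/4) = √(2 - K²)`. -/
lemma F_extremal (h0 : 0 ≤ K) (h1 : K ≤ 1) (hij : i ≠ j) :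
    F (extremal n K i j) = 1 / √(2 - K ^ 2) := by
  have hp := extremal_left_pos h0 h1 hij
  have hq := extremal_nonpos h0 h1 hij hij.symm
  unfold F
  rw [Finset.sum_eq_single_of_mem i (by simpa using hp)
    fun k hk hki => absurd (eq_left_of_extremal_pos h0 h1 hij (by simpa using hk)) hki,
    Finset.prod_eq_single_of_mem j (by simpa using hij.symm) fun k hk hkj => by
      rw [extremal_of_ne (Finset.ne_of_mem_erase hk) hkj]; simp]
  have e : √(2 - K ^ 2) = extremal n K i j i - extremal n K i j j := by
    rw [sqrt_eq_iff_mul_self_eq (by nlinarith) (by linarith), extremal_left hij,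
      extremal_right hij]
    have := extremal_sq h0 h1
    nlinarith
  have hne : extremal n K i j i - extremal n K i j j ≠ 0 := by linarith
  rw [e]
  field_simp

lemma secVol_extremal (hn : 1 ≤ n) (h0 : 0 ≤ K) (h1 : K ≤ 1) (hij : i ≠ j) :
    secVol (extremal n K i j) = ENNReal.ofReal (volBound n K) := by
  have hp := extremal_left_pos h0 h1 hij
  have hq := extremal_nonpos h0 h1 hij hij.symm
  obtain ⟨l, hl, hmem⟩ := exists_list_cons_nodup i
  rw [secVol_eq hn _ (norm_extremal h0 h1 hij) hp (hq.trans_lt hp).ne' hl hmem,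
    ← F_eq_foldr _ (posDistinct_extremal h0 h1 hij) hp hl hmem, F_extremal h0 h1 hij,
    sum_extremal hij, volBound]

end Extremal

/-- At most two entries are non-zero, with sum `K` and sum of squares 1. They are the two roots of a
quadratic, in one order or the other. -/
lemma eq_extremal_of_containsVertices {b : EuclideanSpace ℝ (Fin (n + 1))} (hnorm : ‖b‖ = 1)
    (h0 : 0 ≤ ∑ k, b k) (h1 : ∑ k, b k ≤ 1) (hb : ContainsVertices b) :
    ∃ i j, i ≠ j ∧ b = extremal n (∑ k, b k) i j := by
  obtain ⟨i, j, hij, h⟩ := hb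
  have hz : ∀ k, k ≠ i → k ≠ j → b k = 0 := fun k hi hj =>
    (mem_hyperplane_vertex b k).1 (h k hi hj)
  have hsum := sum_eq_of_support hij hz
  have hsq := norm_sq_eq_sum b
  rw [hnorm, sum_eq_of_support hij fun k hi hj => by rw [hz k hi hj]; norm_num] at hsq
  set K := ∑ k, b k with hK
  have hr := extremal_sq h0 h1
  set r := √(1 / 2 - K ^ 2 / 4) with hrdef
  have hprod : (b i - K / 2 - r) * (b i - K / 2 + r) = 0 := by
    have : b j = K - b i := by linarith
    rw [this] at hsq
    nlinarith
  rcases mul_eq_zero.1 hprod with h2 | h2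
  · refine ⟨i, j, hij, ?_⟩
    ext k
    by_cases hki : k = i
    · rw [hki, extremal_left hij]; linarith
    by_cases hkj : k = j
    · rw [hkj, extremal_right hij]; linarith
    rw [hz k hki hkj, extremal_of_ne hki hkj]
  · refine ⟨j, i, hij.symm, ?_⟩
    ext k
    by_cases hki : k = i
    · rw [hki, extremal_right hij.symm]; linarith
    by_cases hkj : k = j
    · rw [hkj, extremal_left hij.symm]; linarith
    rw [hz k hki hkj, extremal_of_ne hkj hki]

lemma containsVertices_neg {b : EuclideanSpace ℝ (Fin (n + 1))} (hb : ContainsVertices b) :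
    ContainsVertices (-b) := by
  obtain ⟨i, j, hij, h⟩ := hb
  refine ⟨i, j, hij, fun k hi hj => ?_⟩
  have := (mem_hyperplane_vertex b k).1 (h k hi hj)
  rw [mem_hyperplane_vertex]
  simp [this]

lemma secVol_eq_of_containsVertices (hn : 1 ≤ n) {b : EuclideanSpace ℝ (Fin (n + 1))}
    (hnorm : ‖b‖ = 1) (hs : (∑ k, b k) ^ 2 ≤ 1) (hb : ContainsVertices b) :
    secVol b = ENNReal.ofReal (volBound n (∑ k, b k)) := by
  wlog h0 : 0 ≤ ∑ k, b k generalizing b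
  · have := this (b := -b) (by rwa [norm_neg]) (by rwa [sum_neg_apply, neg_sq])
      (containsVertices_neg hb) (by rw [sum_neg_apply]; linarith)
    rwa [secVol_neg, sum_neg_apply, volBound_neg] at this
  have h1 : ∑ k, b k ≤ 1 := by nlinarith
  obtain ⟨i, j, hij, h⟩ := eq_extremal_of_containsVertices hnorm h0 h1 hb
  conv_lhs => rw [h]
  exact secVol_extremal hn h0 h1 hij

end

/-! ### Distance from the centroid. -/

section

variable {n : ℕ}

lemma dist_sq_eq_sum (x y : EuclideanSpace ℝ (Fin (n + 1))) :
    dist x y ^ 2 = ∑ k, (x k - y k) ^ 2 := by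
  rw [dist_eq_norm, norm_sq_eq_sum]
  rfl

lemma centroid_apply (k : Fin (n + 1)) : centroid n k = 1 / ((n : ℝ) + 1) := rfl

lemma isClosed_sec (a : EuclideanSpace ℝ (Fin (n + 1))) : IsClosed (sec a) := by
  have e : sec a = {x | ∑ k, a k * x k = 0} ∩ ({x | ∑ k, x k = 1} ∩ ⋂ k, {x | 0 ≤ x k}) := by
    ext x
    simp [mem_sec_iff]
  rw [e]
  exact (isClosed_eq (by fun_prop) continuous_const).inter
    ((isClosed_eq (by fun_prop) continuous_const).inter
      (isClosed_iInter fun k => isClosed_le continuous_const (by fun_prop)))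

lemma centroid_mem_hyperplane (a : EuclideanSpace ℝ (Fin (n + 1))) :
    centroid n ∈ hyperplane a ↔ ∑ k, a k = 0 := by
  have h : inner ℝ a (centroid n) = (∑ k, a k) * (1 / ((n : ℝ) + 1)) := by
    rw [PiLp.inner_apply, Finset.sum_mul]
    exact Finset.sum_congr rfl fun k _ => by
      simp only [centroid_apply]
      simp [mul_comm]
  have h2 : (1 / ((n : ℝ) + 1)) ≠ 0 := by positivity
  change inner ℝ a (centroid n) = 0 ↔ _
  rw [h, mul_eq_zero, or_iff_left h2]

lemma sum_sub_mean_sq {a : EuclideanSpace ℝ (Fin (n + 1))} (hnorm : ‖a‖ = 1) :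
    ∑ k, (a k - (∑ k, a k) / ((n : ℝ) + 1)) ^ 2 = 1 - (∑ k, a k) ^ 2 / ((n : ℝ) + 1) := by
  have hsq := norm_sq_eq_sum a
  rw [hnorm, one_pow] at hsq
  set K := ∑ k, a k
  have e : ∀ k, (a k - K / ((n : ℝ) + 1)) ^ 2 =
      a k ^ 2 - 2 * (K / ((n : ℝ) + 1)) * a k + (K / ((n : ℝ) + 1)) ^ 2 := fun k => by ring
  simp_rw [e]
  rw [Finset.sum_add_distrib, Finset.sum_sub_distrib, ← Finset.mul_sum, ← hsq]
  have hN : (n : ℝ) + 1 ≠ 0 := by positivity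
  simp only [Finset.sum_const, Finset.card_univ, Fintype.card_fin, nsmul_eq_mul]
  push_cast
  field_simp
  ring

/-- Cauchy–Schwarz for `centroid n - x` and `a` minus its mean, that is, `a` projected to the
direction space of the simplex. Their inner product is `K / (n + 1)`. -/
lemma sum_sq_le_dist_sq {a x : EuclideanSpace ℝ (Fin (n + 1))} (hnorm : ‖a‖ = 1) (hx : x ∈ sec a) :
    (∑ k, a k) ^ 2 ≤ ((n : ℝ) + 1) * ((n : ℝ) + 1 - (∑ k, a k) ^ 2) * dist (centroid n) x ^ 2 := by
  obtain ⟨h1, h2, -⟩ := (mem_sec_iff a x).1 hx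
  have hcs := Finset.sum_mul_sq_le_sq_mul_sq Finset.univ
    (fun k => a k - (∑ k, a k) / ((n : ℝ) + 1)) (fun k => centroid n k - x k)
  rw [sum_sub_mean_sq hnorm, ← dist_sq_eq_sum] at hcs
  set K := ∑ k, a k
  have hN : 0 < (n : ℝ) + 1 := by positivity
  have e : ∑ k, (a k - K / ((n : ℝ) + 1)) * (centroid n k - x k) = K / ((n : ℝ) + 1) := by
    have e' : ∀ k, (a k - K / ((n : ℝ) + 1)) * (centroid n k - x k) =
        1 / ((n : ℝ) + 1) * a k - a k * x k - K / ((n : ℝ) + 1) * (1 / ((n : ℝ) + 1)) +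
          K / ((n : ℝ) + 1) * x k := fun k => by rw [centroid_apply]; ring
    simp_rw [e']
    rw [Finset.sum_add_distrib, Finset.sum_sub_distrib, Finset.sum_sub_distrib, h1]
    simp only [← Finset.mul_sum, h2, Finset.sum_const, Finset.card_univ, Fintype.card_fin, nsmul_eq_mul]
    push_cast
    field_simp
    ring
  rw [e] at hcs
  have := mul_le_mul_of_nonneg_left hcs (sq_nonneg ((n : ℝ) + 1))
  have e2 : ((n : ℝ) + 1) ^ 2 * (K / ((n : ℝ) + 1)) ^ 2 = K ^ 2 := by field_simp
  have e3 : ((n : ℝ) + 1) ^ 2 * ((1 - K ^ 2 / ((n : ℝ) + 1)) * dist (centroid n) x ^ 2) =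
      ((n : ℝ) + 1) * ((n : ℝ) + 1 - K ^ 2) * dist (centroid n) x ^ 2 := by field_simp
  rwa [e2, e3] at this

lemma exists_mem_sec_dist_sq (hn : 1 ≤ n) {a : EuclideanSpace ℝ (Fin (n + 1))} (hnorm : ‖a‖ = 1)
    (hs : (∑ k, a k) ^ 2 ≤ 1) :
    ∃ x ∈ sec a, ((n : ℝ) + 1) * ((n : ℝ) + 1 - (∑ k, a k) ^ 2) * dist (centroid n) x ^ 2 =
      (∑ k, a k) ^ 2 := by
  have hmean := sum_sub_mean_sq hnorm
  have hsq := norm_sq_eq_sum a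
  rw [hnorm, one_pow] at hsq
  have hKdef : ∑ k, a k = ∑ k, a k := rfl
  set K := ∑ k, a k
  have hn' : (1 : ℝ) ≤ n := by exact_mod_cast hn
  have hN : (n : ℝ) + 1 ≠ 0 := by positivity
  have hD : 0 < (n : ℝ) + 1 - K ^ 2 := by linarith
  have hD' := hD.ne'
  -- The orthogonal projection of the centroid onto `H_a` within the hyperplane of the simplex. Its
  -- entries are non-negative because `K² ≤ 1` and `a k ^ 2 ≤ 1`.
  refine ⟨WithLp.toLp 2 fun k => (1 - K * a k) / ((n : ℝ) + 1 - K ^ 2), ?_, ?_⟩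
  · rw [mem_sec_iff]
    refine ⟨?_, ?_, fun k => ?_⟩
    · have e : ∀ k, a k * ((1 - K * a k) / ((n : ℝ) + 1 - K ^ 2)) =
          (a k - K * a k ^ 2) / ((n : ℝ) + 1 - K ^ 2) := fun k => by ring
      simp only [e]
      rw [← Finset.sum_div, Finset.sum_sub_distrib, ← Finset.mul_sum, ← hsq, ← hKdef]
      simp [K]
    · simp only
      rw [← Finset.sum_div, Finset.sum_sub_distrib, ← Finset.mul_sum, ← hKdef]
      simp only [Finset.sum_const, Finset.card_univ, Fintype.card_fin, nsmul_eq_mul]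
      push_cast
      rw [div_eq_one_iff_eq hD']
      ring
    · refine div_nonneg ?_ hD.le
      have h2 : a k ^ 2 ≤ 1 := by
        have := Finset.single_le_sum (f := fun k => a k ^ 2) (fun k _ => sq_nonneg _)
          (Finset.mem_univ k)
        simp only at this
        linarith
      nlinarith [sq_nonneg (K - a k)]
  · have e : ∀ k, (centroid n k - (1 - K * a k) / ((n : ℝ) + 1 - K ^ 2)) ^ 2 =
        (K / ((n : ℝ) + 1 - K ^ 2)) ^ 2 * (a k - K / ((n : ℝ) + 1)) ^ 2 := fun k => by
      rw [← mul_pow, centroid_apply]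
      congr 1
      field_simp
      ring
    rw [dist_sq_eq_sum]
    simp only [e]
    rw [← Finset.mul_sum, hmean]
    field_simp

lemma sum_sq_eq_infDist_sq (hn : 1 ≤ n) {a : EuclideanSpace ℝ (Fin (n + 1))} (hnorm : ‖a‖ = 1)
    (hs : (∑ k, a k) ^ 2 ≤ 1) :
    ((n : ℝ) + 1) * ((n : ℝ) + 1 - (∑ k, a k) ^ 2) * Metric.infDist (centroid n) (sec a) ^ 2 =
      (∑ k, a k) ^ 2 := by
  obtain ⟨x, hx, hdist⟩ := exists_mem_sec_dist_sq hn hnorm hs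
  obtain ⟨y, hy, hy'⟩ := (isClosed_sec a).exists_infDist_eq_dist ⟨x, hx⟩ (centroid n)
  have h1 := sum_sq_le_dist_sq hnorm hy
  rw [← hy'] at h1
  refine le_antisymm (le_trans ?_ hdist.le) h1
  have hn' : (1 : ℝ) ≤ n := by exact_mod_cast hn
  have h2 := Metric.infDist_le_dist_of_mem (x := centroid n) hx
  have h3 : 0 ≤ (n : ℝ) + 1 - (∑ k, a k) ^ 2 := by linarith
  have h4 := Metric.infDist_nonneg (x := centroid n) (s := sec a)
  gcongr

/-- The centroid of the facet is a witness. Only this upper bound is needed, since `d` is assumed to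
be at most the distance to the facet. -/
lemma infDist_facet_sq_le (hn : 1 ≤ n) :
    Metric.infDist (centroid n) (facet n 0) ^ 2 ≤ 1 / ((n : ℝ) * ((n : ℝ) + 1)) := by
  have hn' : (1 : ℝ) ≤ n := by exact_mod_cast hn
  set z : EuclideanSpace ℝ (Fin (n + 1)) := WithLp.toLp 2 (Fin.cons 0 fun _ => 1 / (n : ℝ)) with hz
  have z0 : z 0 = 0 := rfl
  have zs : ∀ k : Fin n, z k.succ = 1 / (n : ℝ) := fun _ => rfl
  have hmem : z ∈ facet n 0 := by
    refine ⟨⟨?_, fun k => ?_⟩, z0⟩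
    · rw [Fin.sum_univ_succ, z0]
      simp only [zs, Finset.sum_const, Finset.card_univ, Fintype.card_fin, nsmul_eq_mul]
      field_simp
      ring
    · induction k using Fin.cases with
      | zero => exact z0.ge
      | succ k => rw [zs]; positivity
  have hd : dist (centroid n) z ^ 2 = 1 / ((n : ℝ) * ((n : ℝ) + 1)) := by
    rw [dist_sq_eq_sum, Fin.sum_univ_succ, z0]
    simp only [zs, centroid_apply, Finset.sum_const, Finset.card_univ, Fintype.card_fin,
      nsmul_eq_mul]
    field_simp
    ring
  rw [← hd]
  have h4 := Metric.infDist_nonneg (x := centroid n) (s := facet n 0)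
  have := Metric.infDist_le_dist_of_mem (x := centroid n) hmem
  gcongr

/-- By `sum_sq_le_dist_sq`, `K² ≤ (n + 1) (n + 1 - K²) d²`. If `K² > 1`, the right side is below 1
or non-positive. -/
lemma sum_sq_le_one_of_atDist (hn : 1 ≤ n) {a : EuclideanSpace ℝ (Fin (n + 1))} {d : ℝ}
    (ha : AtDist d a) (hd : d ^ 2 ≤ 1 / ((n : ℝ) * ((n : ℝ) + 1))) : (∑ k, a k) ^ 2 ≤ 1 := by
  obtain ⟨hnorm, hne, hdist⟩ := ha
  obtain ⟨y, hy, hy'⟩ := (isClosed_sec a).exists_infDist_eq_dist hne (centroid n)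
  have h1 := sum_sq_le_dist_sq hnorm hy
  rw [← hy', hdist] at h1
  have hn' : (1 : ℝ) ≤ n := by exact_mod_cast hn
  rw [le_div_iff₀ (by positivity)] at hd
  by_contra! hK
  by_cases hD : 0 ≤ (n : ℝ) + 1 - (∑ k, a k) ^ 2
  · have h2 := mul_le_mul_of_nonneg_left hd hD
    nlinarith
  · have h2 : ((n : ℝ) + 1) * ((n : ℝ) + 1 - (∑ k, a k) ^ 2) * d ^ 2 ≤ 0 :=
      mul_nonpos_of_nonpos_of_nonneg
        (mul_nonpos_of_nonneg_of_nonpos (by positivity) (not_le.1 hD).le) (sq_nonneg d)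
    linarith

/-- There is a section through `n - 1` vertices at every distance up to the inradius. -/
lemma exists_atDist_containsVertices (hn : 1 ≤ n) {d : ℝ} (h0 : 0 ≤ d)
    (hd : d ^ 2 ≤ 1 / ((n : ℝ) * ((n : ℝ) + 1))) :
    ∃ b : EuclideanSpace ℝ (Fin (n + 1)), AtDist d b ∧ ContainsVertices b := by
  have hn' : (1 : ℝ) ≤ n := by exact_mod_cast hn
  have hN : 0 < (n : ℝ) + 1 := by positivity
  -- The non-negative solution of `(n + 1) (n + 1 - K²) d² = K²`.
  set K := √((((n : ℝ) + 1) ^ 2 * d ^ 2) / (1 + ((n : ℝ) + 1) * d ^ 2)) with hK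
  have hKsq : K ^ 2 = (((n : ℝ) + 1) ^ 2 * d ^ 2) / (1 + ((n : ℝ) + 1) * d ^ 2) :=
    sq_sqrt (by positivity)
  have hK0 : 0 ≤ K := sqrt_nonneg _
  have hK1' : K ^ 2 ≤ 1 := by
    rw [hKsq, div_le_one (by positivity)]
    rw [le_div_iff₀ (by positivity)] at hd
    nlinarith
  have hK1 : K ≤ 1 := by nlinarith
  have hij : (0 : Fin (n + 1)) ≠ Fin.last n := by
    intro h
    have := congrArg Fin.val h
    simp only [Fin.val_zero, Fin.val_last] at this
    omega
  have hnorm := norm_extremal (n := n) hK0 hK1 hij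
  have hsum := sum_extremal (n := n) (K := K) hij
  refine ⟨extremal n K 0 (Fin.last n), ⟨hnorm, ?_, ?_⟩, ?_⟩
  · obtain ⟨x, hx, -⟩ := exists_mem_sec_dist_sq hn hnorm (by rwa [hsum])
    exact ⟨x, hx⟩
  · have h := sum_sq_eq_infDist_sq hn hnorm (by rwa [hsum])
    rw [hsum] at h
    have hD : 0 < (n : ℝ) + 1 - K ^ 2 := by linarith
    have h2 : ((n : ℝ) + 1) * ((n : ℝ) + 1 - K ^ 2) * d ^ 2 = K ^ 2 := by
      have h3 := (eq_div_iff (by positivity)).1 hKsq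
      linarith
    have h3 := mul_left_cancel₀ (mul_pos hN hD).ne' (h.trans h2.symm)
    exact (pow_left_inj₀ Metric.infDist_nonneg h0 two_ne_zero).1 h3
  · exact ⟨0, Fin.last n, hij, fun k h1 h2 =>
      (mem_hyperplane_vertex _ _).2 (extremal_of_ne h1 h2)⟩

end

end SimplexSection

end

/-! ### The theorem. -/

open SimplexSection in
theorem theorem2 (n : ℕ) (hn : 1 ≤ n) :
    -- the sharp bound for the volume, the bound for `F`, and the case of equality
    (∀ K : ℝ, 0 ≤ K → K ≤ 1 →
      (∀ a : EuclideanSpace ℝ (Fin (n + 1)), ‖a‖ = 1 → ∑ j, a j = K →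
        secVol a ≤ ENNReal.ofReal
          (√((n : ℝ) + 1 - K ^ 2) / (Nat.factorial (n - 1) : ℝ) * (1 / √(2 - K ^ 2)))) ∧
      (∀ a : EuclideanSpace ℝ (Fin (n + 1)), ‖a‖ = 1 → ∑ j, a j = K → PosDistinct a →
        F a ≤ 1 / √(2 - K ^ 2)) ∧
      (∀ i j : Fin (n + 1), i ≠ j →
        ‖extremal n K i j‖ = 1 ∧ ∑ k, extremal n K i j k = K ∧
        (∀ k, k ≠ i → k ≠ j → vertex n k ∈ hyperplane (extremal n K i j)) ∧
        PosDistinct (extremal n K i j) ∧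
        secVol (extremal n K i j) = ENNReal.ofReal
          (√((n : ℝ) + 1 - K ^ 2) / (Nat.factorial (n - 1) : ℝ) * (1 / √(2 - K ^ 2))) ∧
        F (extremal n K i j) = 1 / √(2 - K ^ 2))) ∧
    -- among the sections at a fixed distance from the centroid, at most that of a facet, those
    -- that contain `n - 1` vertices exist and are maximal
    (∀ d : ℝ, 0 ≤ d → (∀ j, d ≤ Metric.infDist (centroid n) (facet n j)) →
      (∃ b : EuclideanSpace ℝ (Fin (n + 1)), AtDist d b ∧ ContainsVertices b) ∧
      ∀ b : EuclideanSpace ℝ (Fin (n + 1)), AtDist d b → ContainsVertices b →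
        ∀ a : EuclideanSpace ℝ (Fin (n + 1)), AtDist d a → secVol a ≤ secVol b) ∧
    -- central sections
    (∀ a : EuclideanSpace ℝ (Fin (n + 1)), ‖a‖ = 1 → centroid n ∈ hyperplane a →
      secVol a ≤ ENNReal.ofReal
        (√((n : ℝ) + 1) / (Nat.factorial (n - 1) : ℝ) * (1 / √2)) ∧
      (ContainsVertices a → secVol a = ENNReal.ofReal
        (√((n : ℝ) + 1) / (Nat.factorial (n - 1) : ℝ) * (1 / √2)))) := by
  refine ⟨fun K h0 h1 => ⟨?_, ?_, ?_⟩, fun d h0 hd => ?_, fun a hnorm hc => ?_⟩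
  · rintro a hnorm rfl
    exact secVol_le hn hnorm (by nlinarith)
  · rintro a hnorm rfl hpos
    exact F_le hnorm h0 h1 hpos
  · intro i j hij
    exact ⟨norm_extremal h0 h1 hij, sum_extremal hij,
      fun k hi hj => (mem_hyperplane_vertex _ _).2 (extremal_of_ne hi hj),
      posDistinct_extremal h0 h1 hij, secVol_extremal hn h0 h1 hij, F_extremal h0 h1 hij⟩
  · have hd2 : d ^ 2 ≤ 1 / ((n : ℝ) * ((n : ℝ) + 1)) :=
      (pow_le_pow_left₀ h0 (hd 0) 2).trans (infDist_facet_sq_le hn)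
    refine ⟨exists_atDist_containsVertices hn h0 hd2, fun b hb hbv a ha => ?_⟩
    have hsa := sum_sq_le_one_of_atDist hn ha hd2
    have hsb := sum_sq_le_one_of_atDist hn hb hd2
    have hda := sum_sq_eq_infDist_sq hn ha.1 hsa
    have hdb := sum_sq_eq_infDist_sq hn hb.1 hsb
    rw [ha.2.2] at hda
    rw [hb.2.2] at hdb
    -- The relation between `d` and `K²` is linear in `K²`, with coefficient `1 + (n + 1) d² > 0` up
    -- to the factor `n + 1`... equivalently `(1 + (n + 1) d²) K² = (n + 1)² d²`.
    have hK : (∑ k, a k) ^ 2 = (∑ k, b k) ^ 2 := by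
      have h2 : 0 < 1 + ((n : ℝ) + 1) * d ^ 2 := by positivity
      have h3 : (1 + ((n : ℝ) + 1) * d ^ 2) * (∑ k, a k) ^ 2 =
          (1 + ((n : ℝ) + 1) * d ^ 2) * (∑ k, b k) ^ 2 := by linarith
      exact mul_left_cancel₀ h2.ne' h3
    rw [secVol_eq_of_containsVertices hn hb.1 hsb hbv, ← volBound_congr hK]
    exact secVol_le hn ha.1 hsa
  · have hs := (centroid_mem_hyperplane a).1 hc
    have hb : volBound n (∑ k, a k) =
        √((n : ℝ) + 1) / (Nat.factorial (n - 1) : ℝ) * (1 / √2) := by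
      rw [hs]; simp [volBound]
    have hle : (∑ k, a k) ^ 2 ≤ 1 := by rw [hs]; norm_num
    exact ⟨hb ▸ secVol_le hn hnorm hle,
      fun hv => hb ▸ secVol_eq_of_containsVertices hn hnorm hle hv⟩
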